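/- **Setting (FedGAN).** There are agents $i=1,\dots,B$ with weights $p_i\ge 0$, $\sum_i p_i=1$ (for instance $p_i=|\mathcal R_i|/\sum_j|\mathcal R_j|$ for local datasets $\mathcal R_i$), and losses $\mathcal L_D^i(\theta,w)$, $\mathcal L_G^i(\theta,w)$ of $\theta\in\mathbb R^{d_\theta}$ (generator) and $w\in\mathbb R^{d_w}$ (discriminator), differentiable in $w$ and in $\theta$ respectively. The local true gradients are $g^i=\nabla_w\mathcal L_D^i$ and $h^i=\nabla_\theta\mathcal L_G^i$. The centralized GAN has the pooled losses $\mathcal L_D=\sum_i p_i\mathcal L_D^i$, $\mathcal L_G=\sum_i p_i\mathcal L_G^i$ and the true gradients $g=\nabla_w\mathcal L_D$, $h=\nabla_\theta\mathcal L_G$. At time $n$ agent $i$ draws a random mini-batch $\xi_n^i$ and has the stochastic gradients $\tilde g^i_n(\theta,w)=\tilde g^i(\theta,w;\xi^i_n)$ and $\tilde h^i_n(\theta,w)=\tilde h^i(\theta,w;\xi^i_n)$, where $\tilde g^i,\tilde h^i$ are measurable. Given learning rates $a(n),b(n)$ and a synchronization interval $K\ge1$, all agents start from the same point $(w_0^i,\theta_0^i)=(\hat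 w,\hat\theta)$, and for $n\ge 0$ they compute $$w_{n+1}^i=w_n^i+a(n)\,\tilde g_n^i(\theta_n^i,w_n^i),\qquad \theta_{n+1}^i=\theta_n^i+b(n)\,\tilde h_n^i(\theta_n^i,w_n^i);$$ whenever $n+1$ is a multiple of $K$, every $(w_{n+1}^i,\theta_{n+1}^i)$ is then replaced by the average $\sum_j p_j(w_{n+1}^j,\theta_{n+1}^j)$. Let $z_n=(w_n,\theta_n):=\sum_j p_j(w_n^j,\theta_n^j)$ for all $n$, and let $$M_n^{(w)}=\sum_i p_i\big(g^i(\theta^i_n,w^i_n)-\tilde g^i_n(\theta^i_n,w^i_n)\big),\qquad M_n^{(\theta)}=\sum_i p_i\big(h^i(\theta^i_n,w^i_n)-\tilde h^i_n(\theta^i_n,w^i_n)\big).$$ **Assumptions.** (A1) All $g^i$, $h^i$ are $L$-Lipschitz in $(\theta,w)$. (A2) $a(n)>0$, $\sum_n a(n)=\infty$, $\sum_n a(n)^2<\infty$, and the time scales are equal: $b(n)=a(n)$ for all $n$. (A3) $\{M_n^{(w)}\}$ and $\{M_n^{(\theta)}\}$ are martingale difference sequences with respect to $\mathcal F_n=\sigma(\theta_l,w_l,M_l^{(\theta)},M_l^{(w)}:l\le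 n)$, i.e. they are adapted and integrable and $\mathbb E[M_{n+1}\mid\mathcal F_n]=0$ for all $n\ge0$. (A4) Almost surely $\sup_n\|w_n\|<\infty$ and $\sup_n\|\theta_n\|<\infty$. (A5) The local stochastic gradients used by the algorithm have bounded variance: there are constants $\sigma_g,\sigma_h$ with $\mathbb E\|\tilde g_n^i(\theta_n^i,w_n^i)-g^i(\theta_n^i,w_n^i)\|^2\le\sigma_g^2$ and $\mathbb E\|\tilde h_n^i(\theta_n^i,w_n^i)-h^i(\theta_n^i,w_n^i)\|^2\le\sigma_h^2$ for all $i$ and $n$. **Claim.** Write $z=(w,\theta)$, $q(z)=(g(\theta,w),h(\theta,w))$. Let $t(n)=\sum_{m<n}a(m)$ and let $\bar z:[0,\infty)\to\mathbb R^{d_w}\times\mathbb R^{d_\theta}$ be continuous with $\bar z(t(n))=z_n$ and affine on every $[t(n),t(n+1)]$. Then, almost surely, FedGAN asymptotically tracks the centralized-GAN ODE $\dot z=q(z)$, in the following sense. 1. For each $s\ge0$ the ODE has a unique solution $z^s:\mathbb R\to\mathbb R^{d_w}\times\mathbb R^{d_\theta}$ with $z^s(s)=\bar z(s)$, and for every $T>0$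 $$\lim_{s\to\infty}\ \sup_{t\in[s,s+T]}\|\bar z(t)-z^s(t)\|=0,\qquad \lim_{s\to\infty}\ \sup_{t\in[s-T,s]}\|\bar z(t)-z^s(t)\|=0 .$$ 2. The sequence $(z_n)$ converges to a (possibly sample-path dependent) non-empty, compact, connected, internally chain transitive invariant set $S$ of the ODE, i.e. $\operatorname{dist}(z_n,S)\to0$. Here $S$ is invariant if every solution $z:\mathbb R\to\mathbb R^{d_w}\times\mathbb R^{d_\theta}$ with $z(0)\in S$ satisfies $z(t)\in S$ for all $t\in\mathbb R$; and $S$ is internally chain transitive if for all $x,y\in S$ and $\varepsilon,T>0$ there are $n\ge1$ and points $x=x_0,x_1,\dots,x_n=y$ of $S$ such that, for each $0\le i<n$, the solution started at $x_i$ is within distance less than $\varepsilon$ of $x_{i+1}$ at some time $\ge T$. -/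

import Mathlib

open MeasureTheory Filter Topology Set
open scoped NNReal ENNReal

noncomputable section

/-- `ℝ^d` with the Euclidean norm. -/
abbrev Vec (d : ℕ) : Type := EuclideanSpace ℝ (Fin d)

/-- The data of the FedGAN algorithm with `B` agents, discriminator parameters `w ∈ ℝ^dw`,
generator parameters `θ ∈ ℝ^dθ` and mini-batches in `Ξ`. Only data: all hypotheses are made in the
theorem. -/
structure FedGAN (B dw dθ : ℕ) (Ξ : Type*) where
  /-- weights of the agents -/
  p : Fin B → ℝ
  /-- loss of the local discriminator, as a function of `θ` and `w` -/
  lossD : Fin B → Vec dθ → Vec dw → ℝ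
  /-- loss of the local generator, as a function of `θ` and `w` -/
  lossG : Fin B → Vec dθ → Vec dw → ℝ
  /-- local stochastic gradient of the discriminator, computed from a mini-batch -/
  sgradD : Fin B → Vec dθ → Vec dw → Ξ → Vec dw
  /-- local stochastic gradient of the generator, computed from a mini-batch -/
  sgradG : Fin B → Vec dθ → Vec dw → Ξ → Vec dθ
  /-- learning rate of the discriminators -/
  a : ℕ → ℝ
  /-- learning rate of the generators -/
  b : ℕ → ℝ
  /-- synchronization interval -/
  K : ℕ
  /-- common initial discriminator parameter -/
  wInit : Vec dw
  /-- common initial generator parameter -/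
  θInit : Vec dθ

namespace FedGAN

variable {B dw dθ : ℕ} {Ξ : Type*} (A : FedGAN B dw dθ Ξ)

/-- Local true gradient of the discriminator, `gⁱ(θ, w) = ∇_w L_Dⁱ(θ, w)`. -/
def localG (i : Fin B) (θ : Vec dθ) (w : Vec dw) : Vec dw :=
  gradient (fun w' => A.lossD i θ w') w

/-- Local true gradient of the generator, `hⁱ(θ, w) = ∇_θ L_Gⁱ(θ, w)`. -/
def localH (i : Fin B) (θ : Vec dθ) (w : Vec dw) : Vec dθ :=
  gradient (fun θ' => A.lossG i θ' w) θ

/-- True gradient `g = ∇_w L_D` of the centralized discriminator, whose loss on the pooled data is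
the weighted mean of the local losses. -/
def g (θ : Vec dθ) (w : Vec dw) : Vec dw :=
  gradient (fun w' => ∑ i, A.p i * A.lossD i θ w') w

/-- True gradient `h = ∇_θ L_G` of the centralized generator. -/
def h (θ : Vec dθ) (w : Vec dw) : Vec dθ :=
  gradient (fun θ' => ∑ i, A.p i * A.lossG i θ' w) θ

/-- The vector field `q(z) = (g(θ, w), h(θ, w))` of the centralized ODE, for `z = (w, θ)`. -/
def q (z : Vec dw × Vec dθ) : Vec dw × Vec dθ := (A.g z.2 z.1, A.h z.2 z.1)

/-- One local stochastic gradient step of agent `i` from `z = (w, θ)` at time `n`, with mini-batch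
`x`. -/
def localStep (n : ℕ) (i : Fin B) (z : Vec dw × Vec dθ) (x : Ξ) : Vec dw × Vec dθ :=
  (z.1 + A.a n • A.sgradD i z.2 z.1 x, z.2 + A.b n • A.sgradG i z.2 z.1 x)

/-- The parameters `(wᵢ, θᵢ)` of agent `i` after `n` steps of FedGAN, when `x n i` is the mini-batch
that agent `i` uses in the step from `n` to `n + 1`. Whenever the new time is a multiple of `K`, all
agents replace their parameters by the weighted average. -/
def agent (x : ℕ → Fin B → Ξ) : ℕ → Fin B → Vec dw × Vec dθ
  | 0 => fun _ => (A.wInit, A.θInit)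
  | n + 1 =>
    if (n + 1) % A.K = 0 then
      fun _ => ∑ j, A.p j • A.localStep n j (agent x n j) (x n j)
    else
      fun i => A.localStep n i (agent x n i) (x n i)

/-- The averaged parameters `z_n = (w_n, θ_n)`. -/
def avg (x : ℕ → Fin B → Ξ) (n : ℕ) : Vec dw × Vec dθ := ∑ j, A.p j • A.agent x n j

/-- Weighted error of the discriminators' stochastic gradients that are used at time `n`. -/
def noiseW (x : ℕ → Fin B → Ξ) (n : ℕ) : Vec dw :=
  ∑ i, A.p i • (A.localG i (A.agent x n i).2 (A.agent x n i).1
    - A.sgradD i (A.agent x n i).2 (A.agent x n i).1 (x n i))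

/-- Weighted error of the generators' stochastic gradients that are used at time `n`. -/
def noiseθ (x : ℕ → Fin B → Ξ) (n : ℕ) : Vec dθ :=
  ∑ i, A.p i • (A.localH i (A.agent x n i).2 (A.agent x n i).1
    - A.sgradG i (A.agent x n i).2 (A.agent x n i).1 (x n i))

/-- The time instants `t(n) = a(0) + ⋯ + a(n-1)`. -/
def time (n : ℕ) : ℝ := ∑ m ∈ Finset.range n, A.a m

/-- The index of the interval `[t(n), t(n+1))` that contains `s ≥ 0`. -/
def timeIndex (s : ℝ) : ℕ := sSup {n | A.time n ≤ s}

/-- The continuous piecewise linear interpolation of `z̄(t(n)) = z_n` (only `s ≥ 0` matters). -/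
def zbar (x : ℕ → Fin B → Ξ) (s : ℝ) : Vec dw × Vec dθ :=
  A.avg x (A.timeIndex s) + ((s - A.time (A.timeIndex s)) / A.a (A.timeIndex s)) •
    (A.avg x (A.timeIndex s + 1) - A.avg x (A.timeIndex s))

/-- `F_n = σ(θ_l, w_l, M^θ_l, M^w_l : l ≤ n)`, for random mini-batches `ξ`. -/
@[reducible] def sigmaField {Ω : Type*} (ξ : ℕ → Fin B → Ω → Ξ) (n : ℕ) : MeasurableSpace Ω :=
  ⨆ l ∈ Set.Iic n, MeasurableSpace.comap
    (fun ω => (A.avg (fun m i => ξ m i ω) l, A.noiseW (fun m i => ξ m i ω) l,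
      A.noiseθ (fun m i => ξ m i ω) l)) inferInstance

end FedGAN

/-- `M` is a martingale difference sequence with respect to the increasing σ-fields `F`. -/
structure IsMartingaleDiff {Ω E : Type*} [mΩ : MeasurableSpace Ω] [NormedAddCommGroup E]
    [NormedSpace ℝ E] [CompleteSpace E] (P : Measure Ω) (F : ℕ → MeasurableSpace Ω)
    (M : ℕ → Ω → E) : Prop where
  mono : Monotone F
  le : ∀ n, F n ≤ mΩ
  adapted : ∀ n, StronglyMeasurable[F n] (M n)
  integrable : ∀ n, Integrable (M n) P
  condExp_eq_zero : ∀ n, P[M (n + 1) | F n] =ᵐ[P] 0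

section ODE

variable {E : Type*} [NormedAddCommGroup E] [NormedSpace ℝ E]

/-- `z` solves the autonomous ODE `ż = q(z)` on the whole line. -/
def IsSolution (q : E → E) (z : ℝ → E) : Prop := ∀ t, HasDerivAt z (q (z t)) t

/-- `S` is invariant: a trajectory that is in `S` at time `0` stays in `S` for all `t ∈ ℝ`. -/
def IsInvariantSet (q : E → E) (S : Set E) : Prop :=
  ∀ z : ℝ → E, IsSolution q z → z 0 ∈ S → ∀ t, z t ∈ S

/-- `S` is internally chain transitive: for all `x, y ∈ S` and `ε, T > 0` there are `n ≥ 1` and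
`x = c 0, …, c n = y` in `S` such that for each `i < n` the trajectory started at `c i` meets the
`ε`-neighbourhood of `c (i+1)` after a time `≥ T`. -/
def IsInternallyChainTransitive (q : E → E) (S : Set E) : Prop :=
  ∀ x ∈ S, ∀ y ∈ S, ∀ ε > (0 : ℝ), ∀ T > (0 : ℝ), ∃ n : ℕ, 1 ≤ n ∧ ∃ c : ℕ → E,
    c 0 = x ∧ c n = y ∧ (∀ i ≤ n, c i ∈ S) ∧
    ∀ i < n, ∃ z : ℝ → E, IsSolution q z ∧ z 0 = c i ∧ ∃ t ≥ T, dist (z t) (c (i + 1)) < ε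

/-- The curve `y` asymptotically tracks the ODE `ż = q(z)`: for every `s ≥ 0` there is a unique
trajectory `Z s` that agrees with `y` at time `s`, and for every `T > 0` the suprema of the distance
between `y` and `Z s` over `[s, s+T]` and over `[s-T, s]` tend to `0` as `s → ∞`. -/
def AsymptoticallyTracks (q : E → E) (y : ℝ → E) : Prop :=
  ∃ Z : ℝ → ℝ → E,
    (∀ s ≥ 0, IsSolution q (Z s) ∧ Z s s = y s ∧
      ∀ z : ℝ → E, IsSolution q z → z s = y s → z = Z s) ∧
    ∀ T > (0 : ℝ),
      Tendsto (fun s => ⨆ t ∈ Set.Icc s (s + T), edist (y t) (Z s t)) atTop (𝓝 0) ∧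
      Tendsto (fun s => ⨆ t ∈ Set.Icc (s - T) s, edist (y t) (Z s t)) atTop (𝓝 0)

end ODE

end

/-! Averaging is idempotent, so synchronization does not move the weighted mean: it obeys `z (n+1) =
z n + a n • (q (z n) + e n - M n)`, where the bias `e n` comes from evaluating the local fields at
the agents instead of at the mean (`avg_succ_eq`). This is a stochastic approximation of `ż = q(z)`
once two facts hold almost surely.

The bias vanishes, being at most `L` times the disagreement of the agents. The disagreement is `0`
at multiples of `K`, and one step multiplies it by `1 + O(a n)` and adds a term that tends to `0`;
with at most `K` steps between resets it tends to `0`. The added term is controlled because `∑ a n ^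
2 * E‖error‖ ^ 2 < ∞` forces `a n * ‖error‖ → 0`. Only the means need to be bounded, not the agents.

The noise series `∑ a n • M n` converges, as its partial sums form an `L²`-bounded martingale up to
the initial term. Shifting `z n` by the tail of this series leaves an Euler scheme with vanishing
slope error, and Grönwall's inequality shows that it shadows the ODE on windows of fixed length
(`forwardTracks_of_perturbed_euler`).

The rest is deterministic: the limit set of a bounded continuous curve that shadows a Lipschitz flow
is compact, connected, invariant and internally chain transitive. -/

open MeasureTheory Filter Topology Set
open scoped NNReal ENNReal

noncomputable section

/-! ### Global solutions of Lipschitz autonomous ODEs -/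

section GlobalFlow

variable {E : Type*} [NormedAddCommGroup E] [NormedSpace ℝ E] {q : E → E} {L : ℝ≥0}

/-- Two solutions on overlapping open intervals that agree at a common time can be glued. -/
theorem LipschitzWith.glue_solutions (hq : LipschitzWith L q) {z₁ z₂ : ℝ → E} {a b c d s : ℝ}
    (hac : a ≤ c) (hbd : b ≤ d) (hs : s ∈ Ioo c b)
    (h₁ : ∀ t ∈ Ioo a b, HasDerivAt z₁ (q (z₁ t)) t)
    (h₂ : ∀ t ∈ Ioo c d, HasDerivAt z₂ (q (z₂ t)) t) (h : z₁ s = z₂ s) :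
    ∃ z : ℝ → E, EqOn z z₁ (Ioo a b) ∧ EqOn z z₂ (Ioo c d) ∧
      ∀ t ∈ Ioo a d, HasDerivAt z (q (z t)) t := by
  have heq : EqOn z₁ z₂ (Ioo c b) :=
    ODE_solution_unique_of_mem_Ioo (v := fun _ => q) (s := fun _ => univ) (K := L)
      (fun _ _ => hq.lipschitzOnWith) hs
      (fun t ht => ⟨h₁ t ⟨hac.trans_lt ht.1, ht.2⟩, trivial⟩)
      (fun t ht => ⟨h₂ t ⟨ht.1, ht.2.trans_le hbd⟩, trivial⟩) h
  have e₁ : EqOn (fun t => if t ≤ s then z₁ t else z₂ t) z₁ (Ioo a b) := by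
    intro t ht
    by_cases hts : t ≤ s
    · simp [hts]
    · simp only [hts, if_false]
      exact (heq ⟨hs.1.trans (not_le.1 hts), ht.2⟩).symm
  have e₂ : EqOn (fun t => if t ≤ s then z₁ t else z₂ t) z₂ (Ioo c d) := by
    intro t ht
    by_cases hts : t ≤ s
    · simp only [hts, if_true]
      exact heq ⟨ht.1, hts.trans_lt hs.2⟩
    · simp [hts]
  generalize (fun t => if t ≤ s then z₁ t else z₂ t) = z at e₁ e₂
  refine ⟨z, e₁, e₂, fun t ht => ?_⟩
  rcases lt_or_ge t b with htb | htb
  · have hm : t ∈ Ioo a b := ⟨ht.1, htb⟩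
    rw [e₁ hm]
    exact (h₁ t hm).congr_of_eventuallyEq (e₁.eventuallyEq_of_mem (isOpen_Ioo.mem_nhds hm))
  · have hm : t ∈ Ioo c d := ⟨(hs.1.trans hs.2).trans_le htb, ht.2⟩
    rw [e₂ hm]
    exact (h₂ t hm).congr_of_eventuallyEq (e₂.eventuallyEq_of_mem (isOpen_Ioo.mem_nhds hm))

variable [CompleteSpace E]

/-- Solutions of a Lipschitz autonomous ODE exist for a time that depends only on the Lipschitz
constant. -/
theorem LipschitzWith.exists_local_solution (hq : LipschitzWith L q) :
    ∃ δ > (0 : ℝ), ∀ (s : ℝ) (x : E), ∃ z : ℝ → E, z s = x ∧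
      ∀ t ∈ Ioo (s - δ) (s + δ), HasDerivAt z (q (z t)) t := by
  have hL : 0 ≤ (L : ℝ) := L.2
  refine ⟨1 / (2 * (L + 1)), by positivity, fun s x => ?_⟩
  set δ : ℝ := 1 / (2 * (L + 1)) with hδ
  have hδ0 : 0 < δ := by positivity
  have hδ1 : (L + 1) * δ = 1 / 2 := by rw [hδ]; field_simp
  -- On the ball of radius `‖q x‖` around `x` the speed is at most `(L + 1) * ‖q x‖`, so within time
  -- `δ` a curve moves at most `‖q x‖ / 2`. The radius scales with the speed, hence `δ` does not
  -- depend on `x`.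
  have hP : IsPicardLindelof (fun _ => q) (tmin := s - δ) (tmax := s + δ)
      ⟨s, by constructor <;> linarith⟩ x ‖q x‖₊ 0 (‖q x‖₊ + L * ‖q x‖₊) L :=
    { lipschitzOnWith := fun _ _ => hq.lipschitzOnWith
      continuousOn := fun _ _ => continuousOn_const
      norm_le := fun t _ y hy => by
        have h1 := hq.dist_le_mul y x
        rw [dist_eq_norm] at h1
        have h2 : ‖q y‖ ≤ ‖q x‖ + ‖q y - q x‖ := norm_le_norm_add_norm_sub' _ _
        have h3 : (L : ℝ) * dist y x ≤ L * ‖q x‖ :=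
          mul_le_mul_of_nonneg_left (Metric.mem_closedBall.1 hy) hL
        push_cast
        linarith
      mul_max_le := by
        have : max (s + δ - s) (s - (s - δ)) = δ := by simp
        simp only [this]
        push_cast
        have h0 := norm_nonneg (q x)
        nlinarith }
  obtain ⟨z, hz, hz'⟩ := hP.exists_eq_forall_mem_Icc_hasDerivWithinAt₀
  exact ⟨z, hz, fun t ht =>
    (hz' t (Ioo_subset_Icc_self ht)).hasDerivAt (Icc_mem_nhds ht.1 ht.2)⟩

/-- Solutions of a Lipschitz autonomous ODE exist on the whole line. -/
theorem LipschitzWith.exists_isSolution (hq : LipschitzWith L q) (s : ℝ) (x : E) :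
    ∃ z : ℝ → E, IsSolution q z ∧ z s = x := by
  obtain ⟨δ, hδ, hloc⟩ := hq.exists_local_solution
  have key : ∀ n : ℕ, ∃ z : ℝ → E, z s = x ∧
      ∀ t ∈ Ioo (s - (n + 1) * (δ / 2)) (s + (n + 1) * (δ / 2)), HasDerivAt z (q (z t)) t := by
    intro n
    induction n with
    | zero =>
      obtain ⟨z, hz, hz'⟩ := hloc s x
      exact ⟨z, hz, fun t ht => hz' t ⟨by linarith [ht.1], by linarith [ht.2]⟩⟩
    | succ n ih =>
      obtain ⟨z, hz, hz'⟩ := ih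
      push_cast
      have hn : 0 ≤ n * δ := by positivity
      -- Restarting half a step `δ / 2` inside each end leaves an overlap for gluing and still gains
      -- `δ / 2` on each side.
      obtain ⟨z₁, e₁, h₁⟩ := hloc (s + n * (δ / 2)) (z (s + n * (δ / 2)))
      obtain ⟨z₂, e₂, h₂⟩ := hloc (s - n * (δ / 2)) (z (s - n * (δ / 2)))
      obtain ⟨y, ey, -, hy⟩ := hq.glue_solutions (s := s + n * (δ / 2))
        (c := s + n * (δ / 2) - δ / 2) (d := s + n * (δ / 2) + δ) (by linarith) (by linarith)
        ⟨by linarith, by linarith⟩ hz' (fun t ht => h₁ t ⟨by linarith [ht.1], ht.2⟩) e₁.symm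
      obtain ⟨u, -, eu, hu⟩ := hq.glue_solutions (s := s - n * (δ / 2))
        (a := s - n * (δ / 2) - δ) (b := s - n * (δ / 2) + δ / 2) (by linarith) (by linarith)
        ⟨by linarith, by linarith⟩ (fun t ht => h₂ t ⟨ht.1, by linarith [ht.2]⟩) hy
        (by rw [e₂, ey ⟨by linarith, by linarith⟩])
      refine ⟨u, ?_, fun t ht => hu t ⟨by linarith [ht.1], by linarith [ht.2]⟩⟩
      rw [eu ⟨by linarith, by linarith⟩, ey ⟨by linarith, by linarith⟩, hz]
  choose z hz hz' using key
  have hmono : ∀ m n : ℕ, m ≤ n →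
      EqOn (z m) (z n) (Ioo (s - (m + 1) * (δ / 2)) (s + (m + 1) * (δ / 2))) := by
    intro m n hmn
    have hmn' : (m + 1 : ℝ) * (δ / 2) ≤ (n + 1) * (δ / 2) := by gcongr
    have hm0 : 0 < (m + 1 : ℝ) * (δ / 2) := by positivity
    exact ODE_solution_unique_of_mem_Ioo (v := fun _ => q) (s := fun _ => univ) (K := L) (t₀ := s)
      (fun _ _ => hq.lipschitzOnWith) ⟨by linarith, by linarith⟩
      (fun t ht => ⟨hz' m t ht, trivial⟩)
      (fun t ht => ⟨hz' n t ⟨by linarith [ht.1], by linarith [ht.2]⟩, trivial⟩)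
      ((hz m).trans (hz n).symm)
  have hN : ∀ t : ℝ, ∃ n : ℕ, t ∈ Ioo (s - (n + 1) * (δ / 2)) (s + (n + 1) * (δ / 2)) := by
    intro t
    obtain ⟨n, hn⟩ := exists_nat_gt (|t - s| / (δ / 2))
    rw [div_lt_iff₀ (by positivity)] at hn
    have := abs_lt.1 hn
    exact ⟨n, by linarith [this.1], by linarith [this.2]⟩
  choose N hN using hN
  have hZ : ∀ (n : ℕ) (t : ℝ), t ∈ Ioo (s - (n + 1) * (δ / 2)) (s + (n + 1) * (δ / 2)) →
      z (N t) t = z n t := by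
    intro n t ht
    rcases le_total (N t) n with h | h
    · exact hmono _ _ h (hN t)
    · exact (hmono _ _ h ht).symm
  refine ⟨fun t => z (N t) t, fun t => ?_, hz _⟩
  refine (hz' (N t) t (hN t)).congr_of_eventuallyEq ?_
  filter_upwards [isOpen_Ioo.mem_nhds (hN t)] with r hr using hZ _ r hr


end GlobalFlow

/-! ### Uniqueness and Grönwall estimates -/

section Solutions

variable {E : Type*} [NormedAddCommGroup E] [NormedSpace ℝ E] {q : E → E} {L : ℝ≥0}

theorem IsSolution.continuous {z : ℝ → E} (hz : IsSolution q z) : Continuous z :=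
  continuous_iff_continuousAt.2 fun t => (hz t).continuousAt

theorem IsSolution.comp_add_const {z : ℝ → E} (hz : IsSolution q z) (s : ℝ) :
    IsSolution q fun t => z (t + s) := fun t => (hz (t + s)).comp_add_const t s

theorem IsSolution.eq_of_eq (hq : LipschitzWith L q) {z₁ z₂ : ℝ → E} (h₁ : IsSolution q z₁)
    (h₂ : IsSolution q z₂) {s : ℝ} (h : z₁ s = z₂ s) : z₁ = z₂ :=
  ODE_solution_unique_univ (v := fun _ => q) (s := fun _ => univ) (K := L)
    (fun _ => hq.lipschitzOnWith) (fun t => ⟨h₁ t, trivial⟩) (fun t => ⟨h₂ t, trivial⟩) h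

theorem IsSolution.dist_le_of_le (hq : LipschitzWith L q) {z₁ z₂ : ℝ → E} (h₁ : IsSolution q z₁)
    (h₂ : IsSolution q z₂) {s t : ℝ} (hst : s ≤ t) :
    dist (z₁ t) (z₂ t) ≤ dist (z₁ s) (z₂ s) * Real.exp (L * (t - s)) :=
  dist_le_of_trajectories_ODE (v := fun _ => q) (fun _ => hq) h₁.continuous.continuousOn
    (fun r _ => (h₁ r).hasDerivWithinAt) h₂.continuous.continuousOn
    (fun r _ => (h₂ r).hasDerivWithinAt) le_rfl t ⟨hst, le_rfl⟩

/-- Time reversal keeps the Lipschitz constant, so the forward Grönwall estimate also serves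
backward in time. -/
theorem IsSolution.comp_neg {z : ℝ → E} (hz : IsSolution q z) :
    IsSolution (fun x => -q x) fun t => z (-t) := fun t => by
  have := (hz (-t)).scomp t (hasDerivAt_neg t)
  simpa [Function.comp_def] using this

/-- Grönwall's estimate for two solutions, forward and backward in time. -/
theorem IsSolution.dist_le (hq : LipschitzWith L q) {z₁ z₂ : ℝ → E} (h₁ : IsSolution q z₁)
    (h₂ : IsSolution q z₂) (s t : ℝ) :
    dist (z₁ t) (z₂ t) ≤ dist (z₁ s) (z₂ s) * Real.exp (L * |t - s|) := by
  rcases le_total s t with h | h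
  · rw [abs_of_nonneg (by linarith)]
    exact h₁.dist_le_of_le hq h₂ h
  · rw [abs_of_nonpos (by linarith)]
    have hq' : LipschitzWith L fun x => -q x := hq.neg
    have := h₁.comp_neg.dist_le_of_le hq' h₂.comp_neg (neg_le_neg h)
    simp only [neg_neg] at this
    convert this using 3
    ring

end Solutions

/-! ### Limit sets of bounded curves -/

section LimitSet

variable {E : Type*} [NormedAddCommGroup E] {y : ℝ → E}

/-- The set of limit points of `y t` as `t → ∞`. -/
def limitSet (y : ℝ → E) : Set E := {x | MapClusterPt x atTop y}

theorem frequently_dist_lt_of_mem_limitSet {x : E} (hx : x ∈ limitSet y) {ε : ℝ} (hε : 0 < ε) :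
    ∃ᶠ t in atTop, dist (y t) x < ε :=
  MapClusterPt.frequently hx (Metric.ball_mem_nhds x hε)

variable {C : ℝ}

theorem limitSet_subset_closedBall (hC : ∀ t ≥ 0, ‖y t‖ ≤ C) :
    limitSet y ⊆ Metric.closedBall 0 C := by
  intro x hx
  by_contra h
  obtain ⟨t, ht, ht0⟩ := ((MapClusterPt.frequently hx
    (Metric.isClosed_closedBall.isOpen_compl.mem_nhds h)).and_eventually
      (eventually_ge_atTop 0)).exists
  exact ht (mem_closedBall_zero_iff.2 (hC t ht0))

variable [ProperSpace E]

theorem isCompact_limitSet (hC : ∀ t ≥ 0, ‖y t‖ ≤ C) : IsCompact (limitSet y) :=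
  (isCompact_closedBall 0 C).of_isClosed_subset isClosed_setOfPred_clusterPt
    (limitSet_subset_closedBall hC)

theorem tendsto_nhdsSet_limitSet (hC : ∀ t ≥ 0, ‖y t‖ ≤ C) :
    Tendsto y atTop (𝓝ˢ (limitSet y)) :=
  (isCompact_closedBall (0 : E) C).tendsto_nhdsSet_of_mapClusterPt
    ((eventually_ge_atTop 0).mono fun t ht => mem_closedBall_zero_iff.2 (hC t ht))
    fun _ _ h => h

theorem nonempty_limitSet (hC : ∀ t ≥ 0, ‖y t‖ ≤ C) : (limitSet y).Nonempty := by
  obtain ⟨x, -, hx⟩ := (isCompact_closedBall (0 : E) C).exists_mapClusterPt (f := atTop) (u := y)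
    (le_principal_iff.2 ((eventually_ge_atTop (0 : ℝ)).mono
      fun t ht => mem_closedBall_zero_iff.2 (hC t ht)))
  exact ⟨x, hx⟩

theorem eventually_exists_dist_lt_limitSet (hC : ∀ t ≥ 0, ‖y t‖ ≤ C) {ε : ℝ} (hε : 0 < ε) :
    ∀ᶠ t in atTop, ∃ x ∈ limitSet y, dist (y t) x < ε := by
  have h : Metric.thickening ε (limitSet y) ∈ 𝓝ˢ (limitSet y) :=
    Metric.isOpen_thickening.mem_nhdsSet.2 (Metric.self_subset_thickening hε _)
  filter_upwards [tendsto_nhdsSet_limitSet hC h] with t ht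
  exact Metric.mem_thickening_iff.1 ht

theorem tendsto_infDist_limitSet (hC : ∀ t ≥ 0, ‖y t‖ ≤ C) :
    Tendsto (fun t => Metric.infDist (y t) (limitSet y)) atTop (𝓝 0) := by
  rw [Metric.tendsto_nhds]
  intro ε hε
  filter_upwards [eventually_exists_dist_lt_limitSet hC hε] with t ⟨x, hx, hd⟩
  rw [Real.dist_0_eq_abs, abs_of_nonneg Metric.infDist_nonneg]
  exact (Metric.infDist_le_dist_of_mem hx).trans_lt hd

/-- A splitting into two closed pieces would have disjoint open neighbourhoods `U` and `V`. A tail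
of the curve is connected and lies in `U ∪ V`, hence in one of them, and then no limit point can lie
in the other. -/
theorem isConnected_limitSet (hC : ∀ t ≥ 0, ‖y t‖ ≤ C) (hy : ContinuousOn y (Ici 0)) :
    IsConnected (limitSet y) := by
  refine ⟨nonempty_limitSet hC, ?_⟩
  have hcpt := isCompact_limitSet hC
  rw [isPreconnected_iff_subset_of_fully_disjoint_closed hcpt.isClosed]
  intro u v hu hv huv hd
  obtain ⟨U, V, hU, hV, huU, hvV, hUV⟩ := SeparatedNhds.of_isCompact_isCompact
    (hcpt.inter_right hu) (hcpt.inter_right hv) (hd.mono inter_subset_right inter_subset_right)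
  have hsub : limitSet y ⊆ U ∪ V := fun x hx =>
    (huv hx).imp (fun h => huU ⟨hx, h⟩) fun h => hvV ⟨hx, h⟩
  obtain ⟨T, hT⟩ := eventually_atTop.1
    (tendsto_nhdsSet_limitSet hC ((hU.union hV).mem_nhdsSet.2 hsub))
  have himg : y '' Ici (max T 0) ⊆ U ∪ V := by
    rintro _ ⟨t, ht, rfl⟩
    exact hT t ((le_max_left _ _).trans ht)
  have hpre : IsPreconnected (y '' Ici (max T 0)) :=
    isPreconnected_Ici.image y (hy.mono (Ici_subset_Ici.2 (le_max_right _ _)))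
  have key : ∀ W : Set E, y '' Ici (max T 0) ⊆ W → limitSet y ⊆ closure W := by
    intro W hW x hx
    rw [mem_closure_iff_nhds]
    intro N hN
    obtain ⟨t, ht, htT⟩ := ((MapClusterPt.frequently hx hN).and_eventually
      (eventually_ge_atTop (max T 0))).exists
    exact ⟨y t, ht, hW ⟨t, htT, rfl⟩⟩
  rcases hpre.subset_or_subset hU hV hUV himg with h | h
  · refine Or.inl fun x hx => (huv hx).resolve_right fun hxv => ?_
    exact (hUV.closure_left hV).notMem_of_mem_left (key U h hx) (hvV ⟨hx, hxv⟩)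
  · refine Or.inr fun x hx => (huv hx).resolve_left fun hxu => ?_
    exact (hUV.closure_right hU).notMem_of_mem_left (huU ⟨hx, hxu⟩) (key V h hx)

end LimitSet

/-! ### Curves that shadow the flow, and their limit sets -/

section PseudoTrajectories

variable {E : Type*} [NormedAddCommGroup E] [NormedSpace ℝ E] {q : E → E} {L : ℝ≥0} {y : ℝ → E}

/-- The curve `y` eventually shadows, on time windows of any fixed length, the trajectories of
`ż = q(z)` that start on it. -/
def ForwardTracks (q : E → E) (y : ℝ → E) : Prop :=
  ∀ T > (0 : ℝ), ∀ ε > (0 : ℝ), ∀ᶠ s in atTop, ∀ z : ℝ → E, IsSolution q z → z s = y s →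
    ∀ t ∈ Icc s (s + T), dist (y t) (z t) ≤ ε

/-- The solution `u` that starts on `y` at time `s - T` is `η`-close to `y` on the whole window, in
particular at `s`. Backward Grönwall from `s` then compares `u` with the solution through `y s`, at
the cost of a factor `exp (L * T)`. -/
theorem ForwardTracks.backward [CompleteSpace E] (hq : LipschitzWith L q) (hy : ForwardTracks q y)
    {T ε : ℝ} (hT : 0 < T) (hε : 0 < ε) :
    ∀ᶠ s in atTop, ∀ z : ℝ → E, IsSolution q z → z s = y s →
      ∀ t ∈ Icc (s - T) s, dist (y t) (z t) ≤ ε := by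
  set η := ε / (1 + Real.exp (L * T)) with hη
  have hη0 : 0 < η := by positivity
  have hshift : Tendsto (fun s : ℝ => s - T) atTop atTop :=
    tendsto_atTop_add_const_right _ _ tendsto_id
  filter_upwards [hshift.eventually (hy T hT η hη0)] with s hs z hz hzs t ht
  obtain ⟨u, hu, hus⟩ := hq.exists_isSolution (s - T) (y (s - T))
  have hfw := hs u hu hus
  rw [sub_add_cancel] at hfw
  have h1 := hfw t ht
  have h2 := hfw s ⟨by linarith, le_rfl⟩
  have h3 := hu.dist_le hq hz s t
  rw [hzs, dist_comm (u s)] at h3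
  have h4 : |t - s| ≤ T := by rw [abs_le]; constructor <;> linarith [ht.1, ht.2]
  have h5 : Real.exp (L * |t - s|) ≤ Real.exp (L * T) := by gcongr
  calc dist (y t) (z t) ≤ dist (y t) (u t) + dist (u t) (z t) := dist_triangle _ _ _
    _ ≤ η + η * Real.exp (L * T) := by
        refine add_le_add h1 (h3.trans ?_)
        gcongr
    _ = ε := by rw [hη]; field_simp

theorem ForwardTracks.asymptoticallyTracks [CompleteSpace E] (hq : LipschitzWith L q)
    (hy : ForwardTracks q y) : AsymptoticallyTracks q y := by
  choose Z hZ hZs using fun s => hq.exists_isSolution s (y s)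
  refine ⟨Z,
    fun s _ => ⟨hZ s, hZs s, fun z hz hzs => hz.eq_of_eq hq (hZ s) (hzs.trans (hZs s).symm)⟩,
    fun T hT => ⟨?_, ?_⟩⟩
  all_goals
    rw [ENNReal.tendsto_nhds_zero]
    intro ε hε
    obtain ⟨e, he, hlt⟩ := ENNReal.lt_iff_exists_nnreal_btwn.1 hε
    have he' : (0 : ℝ) < e := by exact_mod_cast he
  · filter_upwards [hy T hT e he'] with s hs
    refine iSup₂_le fun t ht => le_trans ?_ hlt.le
    rw [edist_le_coe]
    exact hs (Z s) (hZ s) (hZs s) t ht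
  · filter_upwards [hy.backward hq hT he'] with s hs
    refine iSup₂_le fun t ht => le_trans ?_ hlt.le
    rw [edist_le_coe]
    exact hs (Z s) (hZ s) (hZs s) t ht

variable {C : ℝ} [ProperSpace E]

/-- If `y` shadows the ODE, then close starting points yield close endpoints at a given time. -/
theorem ForwardTracks.eventually_dist_le (hq : LipschitzWith L q) (hy : ForwardTracks q y)
    {T ε : ℝ} (hT : 0 < T) (hε : 0 < ε) :
    ∀ᶠ s in atTop, ∀ z : ℝ → E, IsSolution q z → ∀ t, |t| ≤ T →
      dist (y (s + t)) (z t) ≤ ε + dist (y s) (z 0) * Real.exp (L * T) := by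
  filter_upwards [hy T hT ε hε, hy.backward hq hT hε] with s hf hb z hz t ht
  obtain ⟨u, hu, hus⟩ := hq.exists_isSolution s (y s)
  have h1 : dist (y (s + t)) (u (s + t)) ≤ ε := by
    rcases le_total 0 t with h | h
    · exact hf u hu hus _ ⟨by linarith, by linarith [le_abs_self t]⟩
    · exact hb u hu hus _ ⟨by linarith [neg_abs_le t], by linarith⟩
  have h2 := (hu.comp_add_const s).dist_le hq hz 0 t
  simp only [zero_add, sub_zero, hus, add_comm t s] at h2
  have h3 : Real.exp (L * |t|) ≤ Real.exp (L * T) := by gcongr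
  calc dist (y (s + t)) (z t) ≤ dist (y (s + t)) (u (s + t)) + dist (u (s + t)) (z t) :=
        dist_triangle _ _ _
    _ ≤ ε + dist (y s) (z 0) * Real.exp (L * T) := by
        refine add_le_add h1 (h2.trans ?_)
        gcongr

/-- Whenever `y s` is close to `z 0`, shadowing makes `y (s + t)` close to `z t`, for either sign of
`t`; this happens at arbitrarily late `s`. -/
theorem ForwardTracks.isInvariantSet_limitSet (hq : LipschitzWith L q) (hy : ForwardTracks q y) :
    IsInvariantSet q (limitSet y) := by
  intro z hz hz0 t
  refine Metric.nhds_basis_ball.mapClusterPt_iff_frequently.2 fun ε hε => ?_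
  set T := |t| + 1
  have hT : 0 < T := by positivity
  set η := ε / (2 * (1 + Real.exp (L * T))) with hη
  have hη0 : 0 < η := by positivity
  have hfr := (frequently_dist_lt_of_mem_limitSet hz0 hη0).and_eventually
    (hy.eventually_dist_le hq hT hη0)
  refine (tendsto_atTop_add_const_right atTop t tendsto_id).frequently (hfr.mono ?_)
  rintro s ⟨hs, hd⟩
  refine (hd z hz t (by simp [T])).trans_lt ?_
  calc η + dist (y s) (z 0) * Real.exp (L * T) ≤ η + η * Real.exp (L * T) := by gcongr
    _ = ε / 2 := by rw [hη]; field_simp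
    _ < ε := half_lt_self hε

/-- The chain is read off the curve itself: between late visits near `x` and near `x'`, sample `y`
at equal time steps and replace each sample by a nearby limit point. -/
theorem ForwardTracks.isInternallyChainTransitive_limitSet (hq : LipschitzWith L q)
    (hy : ForwardTracks q y) (hC : ∀ t ≥ 0, ‖y t‖ ≤ C) :
    IsInternallyChainTransitive q (limitSet y) := by
  intro x hx x' hx' ε hε T hT
  set η := ε / (2 * (2 + Real.exp (L * (2 * T)))) with hη
  have hη0 : 0 < η := by positivity
  obtain ⟨R, hR⟩ := eventually_atTop.1 ((hy.eventually_dist_le hq (mul_pos two_pos hT) hη0).and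
    (eventually_exists_dist_lt_limitSet hC hη0))
  obtain ⟨s, hs, hsR⟩ := ((frequently_dist_lt_of_mem_limitSet hx hη0).and_eventually
    (eventually_ge_atTop R)).exists
  obtain ⟨s', hs', hsT⟩ := ((frequently_dist_lt_of_mem_limitSet hx' hη0).and_eventually
    (eventually_ge_atTop (s + T))).exists
  -- With this number of steps the step length `τ` lies in `[T, 2 * T]`. The upper bound keeps every
  -- step inside one shadowing window of fixed length.
  set n : ℕ := ⌊(s' - s) / T⌋₊ with hn
  have hle : 1 ≤ (s' - s) / T := by rw [le_div_iff₀ hT]; linarith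
  have hn1 : 1 ≤ n := Nat.le_floor (by exact_mod_cast hle)
  have hn0 : (0 : ℝ) < n := by exact_mod_cast hn1
  have hlow : (n : ℝ) * T ≤ s' - s := by
    have := Nat.floor_le (zero_le_one.trans hle)
    rwa [← hn, le_div_iff₀ hT] at this
  have hup : s' - s ≤ (n : ℝ) * (2 * T) := by
    have h1 := (Nat.lt_floor_add_one ((s' - s) / T)).le
    rw [← hn, div_le_iff₀ hT] at h1
    have h2 : (1 : ℝ) ≤ n := by exact_mod_cast hn1
    nlinarith
  set τ := (s' - s) / n with hτ
  have hτT : T ≤ τ := by rw [hτ, le_div_iff₀ hn0]; linarith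
  have hτT' : τ ≤ 2 * T := by rw [hτ, div_le_iff₀ hn0]; linarith
  have hτ0 : 0 < τ := hT.trans_le hτT
  have hr : ∀ i : ℕ, R ≤ s + i * τ := fun i => by
    have : 0 ≤ i * τ := by positivity
    linarith
  choose c hcS hcd using fun i : ℕ => (hR _ (hr i)).2
  have hnτ : s + n * τ = s' := by rw [hτ]; field_simp; ring
  -- The chain must begin and end exactly at `x` and `x'`, which are also `η`-close to the curve at
  -- those two times.
  let c' : ℕ → E := fun i => if i = 0 then x else if i = n then x' else c i
  have hc'S : ∀ i, c' i ∈ limitSet y := fun i => by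
    simp only [c']; split_ifs <;> [exact hx; exact hx'; exact hcS i]
  have hc'd : ∀ i : ℕ, dist (y (s + i * τ)) (c' i) < η := fun i => by
    simp only [c']
    split_ifs with h h
    · simpa [h] using hs
    · rwa [h, hnτ]
    · exact hcd i
  refine ⟨n, hn1, c', by simp [c'], by simp [c', (Nat.one_le_iff_ne_zero.1 hn1)],
    fun i _ => hc'S i, fun i _ => ?_⟩
  obtain ⟨z, hz, hz0⟩ := hq.exists_isSolution 0 (c' i)
  refine ⟨z, hz, hz0, τ, hτT, ?_⟩
  have h1 := (hR _ (hr i)).1 z hz τ (by rwa [abs_of_pos hτ0])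
  have h2 := hc'd (i + 1)
  have e : s + i * τ + τ = s + ((i + 1 : ℕ) : ℝ) * τ := by push_cast; ring
  rw [e, hz0] at h1
  calc dist (z τ) (c' (i + 1)) ≤ dist (y (s + ((i + 1 : ℕ) : ℝ) * τ)) (z τ) +
        dist (y (s + ((i + 1 : ℕ) : ℝ) * τ)) (c' (i + 1)) := dist_triangle_left _ _ _
    _ ≤ (η + η * Real.exp (L * (2 * T))) + η := by
        refine add_le_add (h1.trans ?_) h2.le
        have := (hc'd i).le
        gcongr
    _ = ε / 2 := by rw [hη]; field_simp; ring
    _ < ε := half_lt_self hε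

end PseudoTrajectories

/-! ### Piecewise affine interpolation on the grid of step times -/

section Interpolation

variable {E : Type*} [NormedAddCommGroup E] {a : ℕ → ℝ}

/-- The time reached after `n` steps of lengths `a 0, …, a (n - 1)`. -/
def stepTime (a : ℕ → ℝ) (n : ℕ) : ℝ := ∑ m ∈ Finset.range n, a m

/-- The number of steps of lengths `a 0, a 1, …` completed at time `s`. -/
def stepIndex (a : ℕ → ℝ) (s : ℝ) : ℕ := sSup {n | stepTime a n ≤ s}

/-- The piecewise affine curve that takes the value `z n` at time `stepTime a n`. -/
def interpolant [NormedSpace ℝ E] (a : ℕ → ℝ) (z : ℕ → E) (s : ℝ) : E :=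
  z (stepIndex a s) + ((s - stepTime a (stepIndex a s)) / a (stepIndex a s)) •
    (z (stepIndex a s + 1) - z (stepIndex a s))

theorem stepTime_zero : stepTime a 0 = 0 := by simp [stepTime]

theorem stepTime_succ (n : ℕ) : stepTime a (n + 1) = stepTime a n + a n :=
  Finset.sum_range_succ _ _

theorem strictMono_stepTime (ha : ∀ n, 0 < a n) : StrictMono (stepTime a) :=
  strictMono_nat_of_lt_succ fun n => by rw [stepTime_succ]; linarith [ha n]

theorem stepTime_nonneg (ha : ∀ n, 0 < a n) (n : ℕ) : 0 ≤ stepTime a n :=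
  Finset.sum_nonneg fun m _ => (ha m).le

theorem stepIndex_eq (ha : ∀ n, 0 < a n) {s : ℝ} {n : ℕ}
    (hs : s ∈ Ico (stepTime a n) (stepTime a (n + 1))) : stepIndex a s = n := by
  have : {m | stepTime a m ≤ s} = Iic n := by
    ext m
    refine ⟨fun hm => ?_, fun hm => ((strictMono_stepTime ha).monotone hm).trans hs.1⟩
    exact Nat.lt_succ_iff.1 ((strictMono_stepTime ha).lt_iff_lt.1 (lt_of_le_of_lt hm hs.2))
  rw [stepIndex, this]
  exact csSup_Iic

theorem mem_Ico_stepIndex (ha : ∀ n, 0 < a n) (ht : Tendsto (stepTime a) atTop atTop) {s : ℝ}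
    (hs : 0 ≤ s) :
    s ∈ Ico (stepTime a (stepIndex a s)) (stepTime a (stepIndex a s + 1)) := by
  have hex : ∃ n, s < stepTime a n := (ht.eventually_gt_atTop s).exists
  have h0 : Nat.find hex ≠ 0 := fun h => by
    have := Nat.find_spec hex
    rw [h, stepTime_zero] at this
    linarith
  obtain ⟨n, hn⟩ := Nat.exists_eq_succ_of_ne_zero h0
  have hmem : s ∈ Ico (stepTime a n) (stepTime a (n + 1)) :=
    ⟨not_lt.1 (Nat.find_min hex (by omega)), by have := Nat.find_spec hex; rwa [hn] at this⟩
  rwa [stepIndex_eq ha hmem]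

theorem le_stepIndex (ha : ∀ n, 0 < a n) (ht : Tendsto (stepTime a) atTop atTop) {s : ℝ} {n : ℕ}
    (hs : stepTime a n ≤ s) : n ≤ stepIndex a s := by
  have h0 : 0 ≤ s := (stepTime_nonneg ha n).trans hs
  exact Nat.lt_succ_iff.1 ((strictMono_stepTime ha).lt_iff_lt.1
    (hs.trans_lt (mem_Ico_stepIndex ha ht h0).2))

variable [NormedSpace ℝ E] {z : ℕ → E}

theorem interpolant_of_mem_Icc (ha : ∀ n, 0 < a n) {s : ℝ} {n : ℕ}
    (hs : s ∈ Icc (stepTime a n) (stepTime a (n + 1))) :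
    interpolant a z s = z n + ((s - stepTime a n) / a n) • (z (n + 1) - z n) := by
  -- At the right endpoint `stepIndex` has already jumped to `n + 1`; both affine formulas give `z
  -- (n + 1)` there.
  rcases hs.2.eq_or_lt with h | h
  · have : stepIndex a s = n + 1 :=
      stepIndex_eq ha ⟨h.ge, h.trans_lt (strictMono_stepTime ha (Nat.lt_succ_self _))⟩
    have h1 : s - stepTime a n = a n := by rw [h, stepTime_succ]; ring
    rw [interpolant, this, h1, div_self (ha n).ne', h]
    simp
  · rw [interpolant, stepIndex_eq ha ⟨hs.1, h⟩]

theorem interpolant_stepTime (ha : ∀ n, 0 < a n) (n : ℕ) :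
    interpolant a z (stepTime a n) = z n := by
  rw [interpolant_of_mem_Icc ha ⟨le_rfl, (strictMono_stepTime ha (Nat.lt_succ_self n)).le⟩]
  simp

theorem div_mem_Icc_of_mem_Ico (ha : ∀ n, 0 < a n) {s : ℝ} {n : ℕ}
    (hs : s ∈ Ico (stepTime a n) (stepTime a (n + 1))) :
    (s - stepTime a n) / a n ∈ Icc (0 : ℝ) 1 := by
  have h := hs.2
  rw [stepTime_succ] at h
  exact ⟨div_nonneg (by linarith [hs.1]) (ha n).le, (div_le_one (ha n)).2 (by linarith)⟩

theorem norm_interpolant_le (ha : ∀ n, 0 < a n) (ht : Tendsto (stepTime a) atTop atTop) {C s : ℝ}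
    (hs : 0 ≤ s) (h0 : ‖z (stepIndex a s)‖ ≤ C) (h1 : ‖z (stepIndex a s + 1)‖ ≤ C) :
    ‖interpolant a z s‖ ≤ C := by
  have hc := div_mem_Icc_of_mem_Ico ha (mem_Ico_stepIndex ha ht hs)
  have := (convex_closedBall (0 : E) C).add_smul_sub_mem (mem_closedBall_zero_iff.2 h0)
    (mem_closedBall_zero_iff.2 h1) hc
  exact mem_closedBall_zero_iff.1 this

theorem dist_interpolant_le (ha : ∀ n, 0 < a n) (ht : Tendsto (stepTime a) atTop atTop) {s : ℝ}
    (hs : 0 ≤ s) :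
    dist (interpolant a z s) (z (stepIndex a s)) ≤
      ‖z (stepIndex a s + 1) - z (stepIndex a s)‖ := by
  have hc := div_mem_Icc_of_mem_Ico ha (mem_Ico_stepIndex ha ht hs)
  rw [interpolant, dist_eq_norm, add_sub_cancel_left, norm_smul, Real.norm_of_nonneg hc.1]
  exact mul_le_of_le_one_left (norm_nonneg _) hc.2

/-- Linearity in the sequence allows the noise correction to be interpolated and bounded separately.
-/
theorem interpolant_sub (w : ℕ → E) (s : ℝ) :
    interpolant a (fun n => z n - w n) s = interpolant a z s - interpolant a w s := by
  simp only [interpolant]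
  module

theorem continuousOn_interpolant (ha : ∀ n, 0 < a n) (ht : Tendsto (stepTime a) atTop atTop) :
    ContinuousOn (interpolant a z) (Ici 0) := by
  have hle := stepTime_nonneg ha
  have hpiece : ∀ n, ContinuousOn (interpolant a z) (Icc (stepTime a n) (stepTime a (n + 1))) := by
    intro n
    have : Continuous fun s => z n + ((s - stepTime a n) / a n) • (z (n + 1) - z n) := by
      fun_prop
    exact this.continuousOn.congr fun s hs => interpolant_of_mem_Icc ha hs
  have hIcc : ∀ n, ContinuousOn (interpolant a z) (Icc 0 (stepTime a n)) := by
    intro n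
    induction n with
    | zero => rw [stepTime_zero, Icc_self]; exact continuousOn_singleton _ _
    | succ n ih =>
      rw [← Icc_union_Icc_eq_Icc (hle n) (strictMono_stepTime ha (Nat.lt_succ_self n)).le]
      exact ih.union_of_isClosed (hpiece n) isClosed_Icc isClosed_Icc
  intro s hs
  obtain ⟨n, hn⟩ := (ht.eventually_gt_atTop s).exists
  refine (hIcc n s ⟨hs, hn.le⟩).mono_of_mem_nhdsWithin ?_
  rw [← Ici_inter_Iic]
  exact inter_mem self_mem_nhdsWithin (mem_nhdsWithin_of_mem_nhds (Iic_mem_nhds hn))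

/-- Grönwall's inequality needs only right derivatives, and these exist even at the corners. -/
theorem hasDerivWithinAt_interpolant (ha : ∀ n, 0 < a n) (ht : Tendsto (stepTime a) atTop atTop)
    {s : ℝ} (hs : 0 ≤ s) :
    HasDerivWithinAt (interpolant a z)
      ((a (stepIndex a s))⁻¹ • (z (stepIndex a s + 1) - z (stepIndex a s))) (Ici s) s := by
  have hmem := mem_Ico_stepIndex ha ht hs
  generalize stepIndex a s = n at hmem
  have h1 : HasDerivAt (fun s => z n + ((s - stepTime a n) / a n) • (z (n + 1) - z n))
      ((a n)⁻¹ • (z (n + 1) - z n)) s := by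
    have := (((hasDerivAt_id s).sub_const (stepTime a n)).div_const (a n)).smul_const
      (z (n + 1) - z n)
    simpa using this.const_add (z n)
  refine h1.hasDerivWithinAt.congr_of_eventuallyEq_of_mem ?_ self_mem_Ici
  filter_upwards [Ico_mem_nhdsGE hmem.2] with r hr
  exact interpolant_of_mem_Icc ha ⟨hmem.1.trans hr.1, hr.2.le⟩

end Interpolation

/-! ### From perturbed Euler schemes to shadowing -/

section StochasticApproximation

variable {E : Type*} [NormedAddCommGroup E] [NormedSpace ℝ E] {q : E → E} {L : ℝ≥0} {a : ℕ → ℝ}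

theorem gronwallBound_self_le {K δ x T : ℝ} (hK : 1 ≤ K) (hδ : 0 ≤ δ) (hxT : x ≤ T) :
    gronwallBound δ K δ x ≤ δ * (2 * Real.exp (K * T)) := by
  have hK0 : 0 < K := zero_lt_one.trans_le hK
  rw [gronwallBound_of_K_ne_0 hK0.ne']
  have h1 : Real.exp (K * x) ≤ Real.exp (K * T) := by gcongr
  have h2 : δ / K ≤ δ := div_le_self hδ hK
  have h3 : δ / K * (Real.exp (K * x) - 1) ≤ δ * Real.exp (K * T) :=
    calc δ / K * (Real.exp (K * x) - 1) ≤ δ / K * Real.exp (K * T) := by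
          gcongr; linarith
      _ ≤ δ * Real.exp (K * T) := by gcongr
  have h4 : δ * Real.exp (K * x) ≤ δ * Real.exp (K * T) := by gcongr
  linarith

/-- Interpolated Euler schemes with vanishing errors in the slopes and in the positions shadow the
ODE. -/
theorem forwardTracks_of_perturbed_euler (hq : LipschitzWith L q) (ha : ∀ n, 0 < a n)
    (ha0 : Tendsto a atTop (𝓝 0)) (ht : Tendsto (stepTime a) atTop atTop) {y w e : ℕ → E}
    (hy : ∀ n, y (n + 1) = y n + a n • (q (y n) + e n)) {C : ℝ} (hC : ∀ n, ‖y n‖ ≤ C)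
    (he : Tendsto e atTop (𝓝 0)) (hw : Tendsto w atTop (𝓝 0)) :
    ForwardTracks q (interpolant a fun n => y n - w n) := by
  intro T hT ε hε
  -- Enlarging the Lipschitz constant to at least `1` lets `gronwallBound_self_le` absorb the
  -- division by `K`.
  set K : ℝ≥0 := L + 1 with hKdef
  have hK : (1 : ℝ) ≤ K := by rw [hKdef]; push_cast; linarith [L.2]
  have hqK : LipschitzWith K q := hq.weaken (by simp [hKdef])
  set η := ε / (1 + 2 * Real.exp (K * T)) with hη
  have hη0 : 0 < η := by positivity
  have hqC : ∀ n, ‖q (y n)‖ ≤ ‖q 0‖ + L * C := fun n => by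
    have h1 := hq.dist_le_mul (y n) 0
    rw [dist_eq_norm, dist_zero_right] at h1
    have h2 : ‖q (y n)‖ ≤ ‖q 0‖ + ‖q (y n) - q 0‖ := norm_le_norm_add_norm_sub' _ _
    have h3 : (L : ℝ) * ‖y n‖ ≤ L * C := mul_le_mul_of_nonneg_left (hC n) L.2
    linarith
  have hslope : ∀ n, y (n + 1) - y n = a n • (q (y n) + e n) := fun n => by
    rw [hy n, add_sub_cancel_left]
  have hincr : Tendsto (fun n => ‖y (n + 1) - y n‖) atTop (𝓝 0) := by
    have hlim : Tendsto (fun n => a n * (‖q 0‖ + L * C + ‖e n‖)) atTop (𝓝 0) := by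
      simpa using ha0.mul (he.norm.const_add (‖q 0‖ + L * C))
    refine squeeze_zero (fun _ => norm_nonneg _) (fun n => ?_) hlim
    rw [hslope, norm_smul, Real.norm_of_nonneg (ha n).le]
    refine mul_le_mul_of_nonneg_left ((norm_add_le _ _).trans ?_) (ha n).le
    linarith [hqC n]
  have herr : Tendsto (fun n => ‖e n‖ + L * ‖y (n + 1) - y n‖) atTop (𝓝 0) := by
    simpa using he.norm.add (hincr.const_mul (L : ℝ))
  obtain ⟨N, hN⟩ := eventually_atTop.1 ((herr.eventually_le_const hη0).and
    ((by simpa using hw.norm : Tendsto (fun n => ‖w n‖) atTop (𝓝 0)).eventually_le_const hη0))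
  have hN0 := stepTime_nonneg ha N
  have hwN : ∀ r, stepTime a N ≤ r → ‖interpolant a w r‖ ≤ η := fun r hr => by
    have hk := le_stepIndex ha ht hr
    exact norm_interpolant_le ha ht (hN0.trans hr) (hN _ hk).2 (hN _ (hk.trans (Nat.le_succ _))).2
  filter_upwards [eventually_ge_atTop (stepTime a N)] with s hs z hz hzs t hst
  have hs0 : 0 ≤ s := hN0.trans hs
  -- `z` starts on the interpolant of `y - w`, so its distance to that of `y` is the size of the
  -- interpolated `w`.
  have hinit : dist (interpolant a y s) (z s) ≤ η := by
    rw [hzs, interpolant_sub, dist_eq_norm, sub_sub_cancel]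
    exact hwN s hs
  have hgr := dist_le_of_approx_trajectories_ODE (v := fun _ => q) (a := s) (b := s + T)
    (εf := η) (εg := 0) (fun _ => hqK)
    ((continuousOn_interpolant (z := y) ha ht).mono fun r hr => hs0.trans hr.1)
    (fun r hr => hasDerivWithinAt_interpolant ha ht (hs0.trans hr.1))
    (fun r hr => by
      have hk := le_stepIndex ha ht (hs.trans hr.1)
      have hd := dist_interpolant_le (z := y) ha ht (hs0.trans hr.1)
      have hb := (hN _ hk).1
      set k := stepIndex a r
      rw [hslope, smul_smul, inv_mul_cancel₀ (ha k).ne', one_smul, ← hslope] at *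
      -- The slope is frozen during a step; besides `e k`, the error is how far the field varies
      -- between `y k` and the current point.
      calc dist (q (y k) + e k) (q (interpolant a y r))
          ≤ dist (q (y k) + e k) (q (y k)) + dist (q (y k)) (q (interpolant a y r)) :=
            dist_triangle _ _ _
        _ ≤ ‖e k‖ + L * ‖y (k + 1) - y k‖ := by
            refine add_le_add (by simp [dist_eq_norm]) ((hq.dist_le_mul _ _).trans ?_)
            rw [dist_comm]
            exact mul_le_mul_of_nonneg_left hd L.2
        _ ≤ η := hb)
    hz.continuous.continuousOn (fun r _ => (hz r).hasDerivWithinAt) (fun r _ => by simp) hinit t hst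
  rw [add_zero] at hgr
  have hgr' := hgr.trans (gronwallBound_self_le hK hη0.le (by linarith [hst.2] : t - s ≤ T))
  calc dist (interpolant a (fun n => y n - w n) t) (z t)
      ≤ dist (interpolant a (fun n => y n - w n) t) (interpolant a y t) +
        dist (interpolant a y t) (z t) := dist_triangle _ _ _
    _ ≤ η + η * (2 * Real.exp (K * T)) := by
        refine add_le_add ?_ hgr'
        rw [interpolant_sub, dist_eq_norm, sub_sub_cancel_left, norm_neg]
        exact hwN t (hs.trans hst.1)
    _ = ε := by rw [hη]; field_simp

/-- A bounded stochastic approximation scheme whose weighted noise is summable shadows the ODE. -/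
theorem forwardTracks_of_stochastic_approximation (hq : LipschitzWith L q) (ha : ∀ n, 0 < a n)
    (ha0 : Tendsto a atTop (𝓝 0)) (ht : Tendsto (stepTime a) atTop atTop) {z e m : ℕ → E}
    (hz : ∀ n, z (n + 1) = z n + a n • (q (z n) + e n - m n)) {C : ℝ} (hC : ∀ n, ‖z n‖ ≤ C)
    (he : Tendsto e atTop (𝓝 0)) {l : E}
    (hm : Tendsto (fun n => ∑ k ∈ Finset.range n, a k • m k) atTop (𝓝 l)) :
    ForwardTracks q (interpolant a z) := by
  -- `w` is minus the tail of the noise series. In the recursion for `z + w` the noise cancels,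
  -- leaving the slope error `q (z n) - q (z n + w n)`.
  set w : ℕ → E := fun n => ∑ k ∈ Finset.range n, a k • m k - l with hw
  have hw0 : Tendsto w atTop (𝓝 0) := by simpa [hw] using hm.sub_const l
  have hws : ∀ n, w (n + 1) = w n + a n • m n := fun n => by
    simp only [hw, Finset.sum_range_succ]; abel
  obtain ⟨C', hC'⟩ := hw0.norm.bddAbove_range
  have hdiff : Tendsto (fun n => q (z n) - q (z n + w n)) atTop (𝓝 0) := by
    refine squeeze_zero_norm (a := fun n => L * ‖w n‖) (fun n => ?_)
      (by simpa using hw0.norm.const_mul (L : ℝ))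
    have := hq.dist_le_mul (z n) (z n + w n)
    rwa [dist_self_add_right, dist_eq_norm] at this
  have := forwardTracks_of_perturbed_euler (y := fun n => z n + w n) (w := w)
    (e := fun n => e n + (q (z n) - q (z n + w n))) (C := C + C') hq ha ha0 ht
    (fun n => by rw [hz, hws]; module)
    (fun n => (norm_add_le _ _).trans (add_le_add (hC n) (hC' ⟨n, rfl⟩)))
    (by simpa using he.add hdiff) hw0
  simpa using this

end StochasticApproximation

/-! ### Convergence of weighted martingale-difference series -/

section MartingaleDifferences

variable {Ω : Type*} [mΩ : MeasurableSpace Ω] {P : Measure Ω}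
  {F : ℕ → MeasurableSpace Ω} {a : ℕ → ℝ}

/-- Continuous linear maps commute with conditional expectation; coordinate projections thus reduce
the vector case to scalars. -/
theorem IsMartingaleDiff.clm_comp {E E' : Type*} [NormedAddCommGroup E] [NormedSpace ℝ E]
    [CompleteSpace E] [NormedAddCommGroup E'] [NormedSpace ℝ E'] [CompleteSpace E']
    {M : ℕ → Ω → E} (hM : IsMartingaleDiff P F M) (T : E →L[ℝ] E') :
    IsMartingaleDiff P F fun n ω => T (M n ω) where
  mono := hM.mono
  le := hM.le
  adapted n := T.continuous.comp_stronglyMeasurable (hM.adapted n)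
  integrable n := T.integrable_comp (hM.integrable n)
  condExp_eq_zero n := by
    filter_upwards [T.comp_condExp_comm (m := F n) (hM.integrable (n + 1)), hM.condExp_eq_zero n]
      with ω h1 h2
    have h3 : P[fun ω => T (M (n + 1) ω) | F n] ω = T (P[M (n + 1) | F n] ω) := h1.symm
    rw [h3, h2]
    simp

variable [IsProbabilityMeasure P]

/-- Orthogonality of a martingale difference to the past. -/
theorem IsMartingaleDiff.integral_mul_eq_zero {M : ℕ → Ω → ℝ} (hM : IsMartingaleDiff P F M) {n : ℕ}
    {S : Ω → ℝ} (hS : StronglyMeasurable[F n] S)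
    (hSM : Integrable (S * M (n + 1)) P) : ∫ ω, S ω * M (n + 1) ω ∂P = 0 := by
  have h := condExp_mul_of_stronglyMeasurable_left hS hSM (hM.integrable (n + 1))
  calc ∫ ω, S ω * M (n + 1) ω ∂P = ∫ ω, (P[S * M (n + 1) | F n]) ω ∂P :=
        (integral_condExp (hM.le n)).symm
    _ = ∫ ω, (0 : ℝ) ∂P := by
        refine integral_congr_ae ?_
        filter_upwards [h, hM.condExp_eq_zero n] with ω h1 h2
        rw [h1, Pi.mul_apply, h2, Pi.zero_apply, mul_zero]
    _ = 0 := by simp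

/-- Martingales with square-summable increments converge almost surely (scalar case). -/
theorem IsMartingaleDiff.ae_tendsto_sum_real {M : ℕ → Ω → ℝ} (hM : IsMartingaleDiff P F M)
    (hL2 : ∀ n, MemLp (M n) 2 P) {V : ℝ} (hV : ∀ n, ∫ ω, M n ω ^ 2 ∂P ≤ V)
    (ha : Summable fun n => a n ^ 2) :
    ∀ᵐ ω ∂P, ∃ l, Tendsto (fun n => ∑ k ∈ Finset.range n, a k * M k ω) atTop (𝓝 l) := by
  -- The sum starts at index `1` because nothing is assumed about the mean of `M 0`; its term is
  -- restored at the end.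
  set S : ℕ → Ω → ℝ := fun n ω => ∑ k ∈ Finset.range n, a (k + 1) * M (k + 1) ω with hS
  have hsucc : ∀ n, S (n + 1) = fun ω => S n ω + a (n + 1) * M (n + 1) ω := fun n => by
    funext ω
    simp only [hS, Finset.sum_range_succ]
  have hSL2 : ∀ n, MemLp (S n) 2 P := fun n =>
    memLp_finsetSum _ fun k _ => (hL2 (k + 1)).const_mul (a (k + 1))
  have hSm : ∀ n, StronglyMeasurable[F n] (S n) := fun n => by
    refine Finset.stronglyMeasurable_fun_sum (Finset.range n) fun k hk => ?_
    exact ((hM.adapted (k + 1)).mono (hM.mono (Finset.mem_range.1 hk))).const_mul (a (k + 1))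
  -- Increments are orthogonal to the past, so second moments add up.
  have hsq : ∀ n, ∫ ω, S n ω ^ 2 ∂P ≤ (∑ k ∈ Finset.range n, a (k + 1) ^ 2) * V := by
    intro n
    induction n with
    | zero => simp [hS]
    | succ n ih =>
      have hint : Integrable (S n * M (n + 1)) P := (hSL2 n).integrable_mul (hL2 (n + 1))
      have horth := hM.integral_mul_eq_zero (hSm n) hint
      have e : ∀ ω, S (n + 1) ω ^ 2 =
          S n ω ^ 2 + 2 * a (n + 1) * (S n ω * M (n + 1) ω) + a (n + 1) ^ 2 * M (n + 1) ω ^ 2 :=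
        fun ω => by rw [hsucc]; ring
      have i1 : Integrable (fun ω => S n ω ^ 2) P := (hSL2 n).integrable_sq
      have i2 : Integrable (fun ω => 2 * a (n + 1) * (S n ω * M (n + 1) ω)) P := hint.const_mul _
      have i3 : Integrable (fun ω => a (n + 1) ^ 2 * M (n + 1) ω ^ 2) P :=
        (hL2 (n + 1)).integrable_sq.const_mul _
      have i12 : Integrable
          (fun ω => S n ω ^ 2 + 2 * a (n + 1) * (S n ω * M (n + 1) ω)) P := i1.add i2
      simp_rw [e]
      rw [integral_add i12 i3, integral_add i1 i2, integral_const_mul, integral_const_mul,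
        horth, Finset.sum_range_succ, add_mul]
      have := mul_le_mul_of_nonneg_left (hV (n + 1)) (sq_nonneg (a (n + 1)))
      linarith
  have hV0 : 0 ≤ V := (integral_nonneg fun ω => sq_nonneg (M 0 ω)).trans (hV 0)
  have ha' : Summable fun n => a (n + 1) ^ 2 := (summable_nat_add_iff 1).2 ha
  -- The convergence theorem asks for an `L¹` bound, obtained from `|S| ≤ 1 + S ^ 2`.
  set R : ℝ := 1 + (∑' k, a (k + 1) ^ 2) * V with hR
  have hL1 : ∀ n, eLpNorm (S n) 1 P ≤ (R.toNNReal : ℝ≥0∞) := by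
    intro n
    have hi : Integrable (S n) P := (hSL2 n).integrable (by norm_num)
    rw [eLpNorm_one_eq_lintegral_enorm, ← ofReal_integral_norm_eq_lintegral_enorm hi]
    refine ENNReal.ofReal_le_ofReal ?_
    calc ∫ ω, ‖S n ω‖ ∂P ≤ ∫ ω, (1 + S n ω ^ 2) ∂P := by
          refine integral_mono hi.norm ((integrable_const _).add (hSL2 n).integrable_sq) fun ω => ?_
          simp only [Real.norm_eq_abs]
          nlinarith [sq_abs (S n ω), sq_nonneg (|S n ω| - 1)]
      _ = 1 + ∫ ω, S n ω ^ 2 ∂P := by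
          rw [integral_add (integrable_const _) (hSL2 n).integrable_sq]
          simp
      _ ≤ R := by
          have := mul_le_mul_of_nonneg_right
            (ha'.sum_le_tsum (Finset.range n) fun k _ => sq_nonneg _) hV0
          linarith [hsq n]
  let ℱ : Filtration ℕ mΩ := ⟨F, hM.mono, hM.le⟩
  have hmart : Martingale S ℱ P := by
    refine martingale_of_condExp_sub_eq_zero_nat hSm (fun n => (hSL2 n).integrable (by norm_num))
      fun n => ?_
    have e : S (n + 1) - S n = a (n + 1) • M (n + 1) := by
      rw [hsucc]; funext ω; simp
    rw [e]
    filter_upwards [condExp_smul (μ := P) (a (n + 1)) (M (n + 1)) (F n), hM.condExp_eq_zero n]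
      with ω h1 h2
    exact h1.trans (by simp [h2])
  filter_upwards [hmart.submartingale.exists_ae_tendsto_of_bdd hL1] with ω ⟨l, hl⟩
  refine ⟨l + a 0 * M 0 ω, (tendsto_add_atTop_iff_nat 1).1 ?_⟩
  simp_rw [Finset.sum_range_succ' _ _]
  exact hl.add_const _

/-- Martingales with square-summable increments converge almost surely. -/
theorem IsMartingaleDiff.ae_tendsto_sum {d : ℕ} {M : ℕ → Ω → Vec d} (hM : IsMartingaleDiff P F M)
    (hL2 : ∀ n, MemLp (M n) 2 P) {V : ℝ} (hV : ∀ n, ∫ ω, ‖M n ω‖ ^ 2 ∂P ≤ V)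
    (ha : Summable fun n => a n ^ 2) :
    ∀ᵐ ω ∂P, ∃ l, Tendsto (fun n => ∑ k ∈ Finset.range n, a k • M k ω) atTop (𝓝 l) := by
  have hcoord : ∀ i : Fin d, ∀ᵐ ω ∂P, ∃ l,
      Tendsto (fun n => ∑ k ∈ Finset.range n, a k * M k ω i) atTop (𝓝 l) := by
    intro i
    have hle : ∀ n ω, ‖M n ω i‖ ≤ ‖M n ω‖ := fun n ω => PiLp.norm_apply_le (M n ω) i
    have hMi := hM.clm_comp (EuclideanSpace.proj (𝕜 := ℝ) i : Vec d →L[ℝ] ℝ)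
    have hL2i : ∀ n, MemLp (fun ω => M n ω i) 2 P := fun n =>
      (hL2 n).of_le (hMi.integrable n).aestronglyMeasurable (.of_forall (hle n))
    refine hMi.ae_tendsto_sum_real hL2i (V := V) (fun n => le_trans ?_ (hV n)) ha
    refine integral_mono (hL2i n).integrable_sq ((hL2 n).integrable_norm_pow two_ne_zero) fun ω => ?_
    have := pow_le_pow_left₀ (norm_nonneg _) (hle n ω) 2
    simpa using this
  filter_upwards [ae_all_iff.2 hcoord] with ω h
  choose l hl using h
  refine ⟨WithLp.toLp 2 l, ?_⟩
  have := (PiLp.continuous_toLp 2 (fun _ : Fin d => ℝ)).tendsto l |>.comp (tendsto_pi_nhds.2 hl)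
  refine this.congr fun n => ?_
  ext i
  simp [Finset.sum_apply]

end MartingaleDifferences

/-! ### Consequences of bounded second moments -/

section SquareIntegrable

variable {Ω E : Type*} [MeasurableSpace Ω] {P : Measure Ω} [NormedAddCommGroup E]

theorem memLp_two_of_lintegral_enorm_sq_le {f : Ω → E} (hf : AEStronglyMeasurable f P) {V : ℝ}
    (hV : ∫⁻ ω, ‖f ω‖ₑ ^ 2 ∂P ≤ ENNReal.ofReal V) : MemLp f 2 P := by
  refine ⟨hf, (eLpNorm_lt_top_iff_lintegral_rpow_enorm_lt_top two_ne_zero ENNReal.ofNat_ne_top).2 ?_⟩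
  simpa using hV.trans_lt ENNReal.ofReal_lt_top

theorem integral_norm_sq_le_of_lintegral {f : Ω → E} (hf : AEStronglyMeasurable f P) {V : ℝ}
    (hV0 : 0 ≤ V) (hV : ∫⁻ ω, ‖f ω‖ₑ ^ 2 ∂P ≤ ENNReal.ofReal V) : ∫ ω, ‖f ω‖ ^ 2 ∂P ≤ V := by
  rw [integral_eq_lintegral_of_nonneg_ae (.of_forall fun ω => sq_nonneg _) (hf.norm.pow 2)]
  refine ENNReal.toReal_le_of_le_ofReal hV0 (le_trans (le_of_eq ?_) hV)
  refine lintegral_congr fun ω => ?_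
  rw [ENNReal.ofReal_pow (norm_nonneg _), ofReal_norm]

/-- The series `∑ a n ^ 2 * ‖f n‖ ^ 2` has finite expectation, so it is almost surely finite and its
terms tend to `0`. No martingale property is needed, which matters for the errors of single agents.
-/
theorem ae_tendsto_mul_norm_of_summable_sq {f : ℕ → Ω → E}
    (hf : ∀ n, AEStronglyMeasurable (f n) P) {a : ℕ → ℝ} (ha : Summable fun n => a n ^ 2) {V : ℝ}
    (hV : ∀ n, ∫⁻ ω, ‖f n ω‖ₑ ^ 2 ∂P ≤ ENNReal.ofReal V) :
    ∀ᵐ ω ∂P, Tendsto (fun n => a n * ‖f n ω‖) atTop (𝓝 0) := by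
  have hmeas : ∀ n, AEMeasurable (fun ω => ENNReal.ofReal (a n ^ 2) * ‖f n ω‖ₑ ^ 2) P := fun n =>
    ((hf n).enorm.pow_const 2).const_mul _
  have hfin : ∫⁻ ω, ∑' n, ENNReal.ofReal (a n ^ 2) * ‖f n ω‖ₑ ^ 2 ∂P ≠ ∞ := by
    rw [lintegral_tsum hmeas]
    refine ne_top_of_le_ne_top (b := (∑' n, ENNReal.ofReal (a n ^ 2)) * ENNReal.ofReal V) ?_ ?_
    · rw [← ENNReal.ofReal_tsum_of_nonneg (fun n => sq_nonneg _) ha]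
      exact ENNReal.mul_ne_top ENNReal.ofReal_ne_top ENNReal.ofReal_ne_top
    · rw [← ENNReal.tsum_mul_right]
      refine ENNReal.tsum_le_tsum fun n => ?_
      rw [lintegral_const_mul' _ _ ENNReal.ofReal_ne_top]
      gcongr
      exact hV n
  filter_upwards [ae_lt_top' (AEMeasurable.tsum hmeas) hfin] with ω hω
  have h1 := (ENNReal.tendsto_toReal ENNReal.zero_ne_top).comp
    (ENNReal.tendsto_atTop_zero_of_tsum_ne_top hω.ne)
  have h2 : Tendsto (fun n => (a n * ‖f n ω‖) ^ 2) atTop (𝓝 0) := by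
    refine h1.congr fun n => ?_
    simp [mul_pow, ENNReal.toReal_ofReal (sq_nonneg (a n))]
  have h3 := h2.sqrt
  simp only [Real.sqrt_sq_eq_abs, Real.sqrt_zero] at h3
  exact tendsto_zero_iff_abs_tendsto_zero _ |>.2 h3

end SquareIntegrable

/-- A nonnegative sequence with almost multiplicative increments that is reset to `0` at all
multiples of `K` tends to `0`. -/
theorem tendsto_zero_of_periodic_reset {D α β : ℕ → ℝ} {K : ℕ} (hK : 0 < K) (hD : ∀ n, 0 ≤ D n)
    (hα : Tendsto α atTop (𝓝 0)) (hβ : Tendsto β atTop (𝓝 0)) (hreset : ∀ n, n % K = 0 → D n = 0)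
    (hstep : ∀ n, D (n + 1) ≤ (1 + α n) * D n + β n) : Tendsto D atTop (𝓝 0) := by
  -- Induction on the phase within a period: residue `0` is the reset, each further residue costs
  -- one use of `hstep`, and `j = K` covers every `n`.
  have key : ∀ j : ℕ, Tendsto (fun n => if n % K ≤ j then D n else 0) atTop (𝓝 0) := by
    intro j
    induction j with
    | zero =>
      refine tendsto_const_nhds.congr fun n => ?_
      split_ifs with h
      · exact (hreset n (Nat.le_zero.1 h)).symm
      · rfl
    | succ j ih =>
      refine (tendsto_add_atTop_iff_nat 1).1 ?_
      have hlim : Tendsto (fun n => |1 + α n| * (if n % K ≤ j then D n else 0) + |β n|) atTop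
          (𝓝 0) := by
        simpa using ((hα.const_add 1).abs.mul ih).add hβ.abs
      have hnn : ∀ n, 0 ≤ |1 + α n| * (if n % K ≤ j then D n else 0) + |β n| := fun n => by
        have : 0 ≤ if n % K ≤ j then D n else 0 := by split_ifs <;> [exact hD n; exact le_rfl]
        positivity
      refine squeeze_zero (fun n => ?_) (fun n => ?_) hlim
      · split_ifs <;> [exact hD _; exact le_rfl]
      · by_cases h0 : (n + 1) % K = 0
        · rw [hreset _ h0, ite_self]
          exact hnn n
        by_cases h : (n + 1) % K ≤ j + 1
        · have hmod : n % K ≤ j := by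
            have h1 := Nat.add_mod n 1 K
            have h2 := Nat.mod_lt n hK
            rcases Nat.lt_or_ge (n % K + 1) K with h3 | h3
            · have : (n + 1) % K = n % K + 1 := by
                rw [← Nat.mod_add_mod, Nat.mod_eq_of_lt h3]
              omega
            · exfalso
              have : n % K + 1 = K := by omega
              apply h0
              rw [← Nat.mod_add_mod, this, Nat.mod_self]
          rw [if_pos h, if_pos hmod]
          refine (hstep n).trans (add_le_add ?_ (le_abs_self _))
          exact mul_le_mul_of_nonneg_right (le_abs_self _) (hD n)
        · rw [if_neg h]
          exact hnn n
  refine (key K).congr fun n => if_pos (Nat.mod_lt n hK).le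

/-! ### FedGAN along one sample path -/

namespace FedGAN

variable {B dw dθ : ℕ} {Ξ : Type*} (A : FedGAN B dw dθ Ξ)

/-- The local true gradients of agent `i`, as a vector field. -/
def localField (i : Fin B) (z : Vec dw × Vec dθ) : Vec dw × Vec dθ :=
  (A.localG i z.2 z.1, A.localH i z.2 z.1)

/-- The error of the stochastic gradients of agent `i` at time `n`. -/
def localError (x : ℕ → Fin B → Ξ) (n : ℕ) (i : Fin B) : Vec dw × Vec dθ :=
  (A.sgradD i (A.agent x n i).2 (A.agent x n i).1 (x n i)
      - A.localG i (A.agent x n i).2 (A.agent x n i).1,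
    A.sgradG i (A.agent x n i).2 (A.agent x n i).1 (x n i)
      - A.localH i (A.agent x n i).2 (A.agent x n i).1)

/-- Total distance of the agents to their weighted average. -/
def disagreement (x : ℕ → Fin B → Ξ) (n : ℕ) : ℝ := ∑ i, ‖A.agent x n i - A.avg x n‖

variable {A} {L : ℝ≥0} {x : ℕ → Fin B → Ξ}

theorem gradient_sum_const_mul {d : ℕ} (p : Fin B → ℝ) {f : Fin B → Vec d → ℝ}
    (hf : ∀ i, Differentiable ℝ (f i)) (v : Vec d) :
    gradient (fun v => ∑ i, p i * f i v) v = ∑ i, p i • gradient (f i) v := by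
  simp only [gradient]
  rw [fderiv_fun_sum fun i _ => ((hf i v).const_mul (p i)), map_sum]
  refine Finset.sum_congr rfl fun i _ => ?_
  rw [fderiv_const_mul (hf i v), map_smulₛₗ]
  rfl

/-- Differentiability of the losses matters here: without it, `gradient` takes a default value and
need not be additive. -/
theorem q_eq_sum (hdD : ∀ i θ, Differentiable ℝ fun w => A.lossD i θ w)
    (hdG : ∀ i w, Differentiable ℝ fun θ => A.lossG i θ w) (z : Vec dw × Vec dθ) :
    A.q z = ∑ i, A.p i • A.localField i z := by
  refine Prod.ext ?_ ?_
  · simp only [q, g, localField, localG, Prod.fst_sum, Prod.smul_fst]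
    exact gradient_sum_const_mul A.p (fun i => hdD i z.2) z.1
  · simp only [q, h, localField, localH, Prod.snd_sum, Prod.smul_snd]
    exact gradient_sum_const_mul A.p (fun i => hdG i z.1) z.2

theorem lipschitzWith_localField
    (hLg : ∀ i, LipschitzWith L fun z : Vec dw × Vec dθ => A.localG i z.2 z.1)
    (hLh : ∀ i, LipschitzWith L fun z : Vec dw × Vec dθ => A.localH i z.2 z.1) (i : Fin B) :
    LipschitzWith L (A.localField i) := by
  have := (hLg i).prodMk (hLh i)
  rwa [max_self] at this

theorem norm_sum_smul_le {F : Type*} [NormedAddCommGroup F] [NormedSpace ℝ F] (hp : ∀ i, 0 ≤ A.p i)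
    (hp1 : ∑ i, A.p i = 1) {v : Fin B → F} {C : ℝ} (hv : ∀ i, ‖v i‖ ≤ C) :
    ‖∑ i, A.p i • v i‖ ≤ C :=
  calc ‖∑ i, A.p i • v i‖ ≤ ∑ i, A.p i * C := norm_sum_le_of_le _ fun i _ => by
        rw [norm_smul, Real.norm_of_nonneg (hp i)]
        exact mul_le_mul_of_nonneg_left (hv i) (hp i)
    _ = C := by rw [← Finset.sum_mul, hp1, one_mul]

/-- By Jensen's inequality the averaged noise inherits the agents' variance bound. -/
theorem norm_sum_smul_sq_le {F : Type*} [NormedAddCommGroup F] [NormedSpace ℝ F]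
    (hp : ∀ i, 0 ≤ A.p i) (hp1 : ∑ i, A.p i = 1) (v : Fin B → F) :
    ‖∑ i, A.p i • v i‖ ^ 2 ≤ ∑ i, A.p i * ‖v i‖ ^ 2 := by
  have h1 : ‖∑ i, A.p i • v i‖ ≤ ∑ i, A.p i * ‖v i‖ := norm_sum_le_of_le _ fun i _ => by
    rw [norm_smul, Real.norm_of_nonneg (hp i)]
  exact (pow_le_pow_left₀ (norm_nonneg _) h1 2).trans
    (Real.pow_arith_mean_le_arith_mean_pow _ A.p (fun i => ‖v i‖) (fun i _ => hp i) hp1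
      (fun i _ => norm_nonneg _) 2)

theorem lipschitzWith_q (hp : ∀ i, 0 ≤ A.p i) (hp1 : ∑ i, A.p i = 1)
    (hq : ∀ z, A.q z = ∑ i, A.p i • A.localField i z)
    (hL : ∀ i, LipschitzWith L (A.localField i)) : LipschitzWith L A.q := by
  refine LipschitzWith.of_dist_le_mul fun z z' => ?_
  rw [hq, hq, dist_eq_norm, ← Finset.sum_sub_distrib]
  simp_rw [← smul_sub]
  exact norm_sum_smul_le hp hp1 fun i => by
    rw [← dist_eq_norm]
    exact (hL i).dist_le_mul z z'

theorem localStep_eq (hab : ∀ n, A.a n = A.b n) (n : ℕ) (i : Fin B) :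
    A.localStep n i (A.agent x n i) (x n i) = A.agent x n i +
      A.a n • (A.localField i (A.agent x n i) + A.localError x n i) := by
  refine Prod.ext ?_ ?_
  · simp [localStep, localField, localError]
  · simp [localStep, localField, localError, hab]

theorem sum_smul_const {F : Type*} [AddCommGroup F] [Module ℝ F] (hp1 : ∑ i, A.p i = 1) (v : F) :
    ∑ i, A.p i • v = v := by
  rw [← Finset.sum_smul, hp1, one_smul]

theorem avg_succ (hp1 : ∑ i, A.p i = 1) (n : ℕ) :
    A.avg x (n + 1) = ∑ j, A.p j • A.localStep n j (A.agent x n j) (x n j) := by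
  rw [avg]
  simp only [agent]
  split_ifs
  · exact sum_smul_const hp1 _
  · rfl

theorem avg_succ_eq_add (hp1 : ∑ i, A.p i = 1) (hab : ∀ n, A.a n = A.b n) (n : ℕ) :
    A.avg x (n + 1) = A.avg x n + A.a n •
      ∑ j, A.p j • (A.localField j (A.agent x n j) + A.localError x n j) := by
  rw [avg_succ hp1]
  simp only [localStep_eq hab, avg, smul_add, Finset.sum_add_distrib, Finset.smul_sum,
    smul_comm (A.a n)]

theorem noise_eq (n : ℕ) :
    (A.noiseW x n, A.noiseθ x n) = -∑ j, A.p j • A.localError x n j := by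
  refine Prod.ext ?_ ?_ <;>
    simp [noiseW, noiseθ, localError, Prod.fst_sum, Prod.snd_sum, ← Finset.sum_neg_distrib,
      ← smul_neg]

theorem avg_succ_eq (hp1 : ∑ i, A.p i = 1) (hab : ∀ n, A.a n = A.b n)
    (hq : ∀ z, A.q z = ∑ i, A.p i • A.localField i z) (n : ℕ) :
    A.avg x (n + 1) = A.avg x n + A.a n • (A.q (A.avg x n) +
      ∑ j, A.p j • (A.localField j (A.agent x n j) - A.localField j (A.avg x n)) -
      (A.noiseW x n, A.noiseθ x n)) := by
  rw [avg_succ_eq_add hp1 hab, noise_eq, hq]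
  simp only [smul_add, smul_sub, Finset.sum_add_distrib, Finset.sum_sub_distrib]
  module

theorem disagreement_nonneg (n : ℕ) : 0 ≤ A.disagreement x n :=
  Finset.sum_nonneg fun _ _ => norm_nonneg _

theorem norm_agent_sub_avg_le (n : ℕ) (i : Fin B) :
    ‖A.agent x n i - A.avg x n‖ ≤ A.disagreement x n :=
  Finset.single_le_sum (f := fun i => ‖A.agent x n i - A.avg x n‖) (fun _ _ => norm_nonneg _)
    (Finset.mem_univ i)

theorem disagreement_eq_zero (hp1 : ∑ i, A.p i = 1) {n : ℕ} (hn : n % A.K = 0) :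
    A.disagreement x n = 0 := by
  refine Finset.sum_eq_zero fun i _ => ?_
  cases n with
  | zero =>
    have : A.avg x 0 = (A.wInit, A.θInit) := sum_smul_const hp1 _
    rw [this, agent, sub_self, norm_zero]
  | succ n =>
    rw [avg_succ hp1, agent, if_pos hn, sub_self, norm_zero]

/-- Away from synchronization, a deviation from the mean changes by `a n` times the difference of
two drifts, each of norm at most `G + L * D + N`. Comparing the local fields with their values at
the mean avoids any bound on the agents themselves. -/
theorem disagreement_succ_le (hp : ∀ i, 0 ≤ A.p i) (hp1 : ∑ i, A.p i = 1)
    (hab : ∀ n, A.a n = A.b n) (ha : ∀ n, 0 < A.a n) (hL : ∀ i, LipschitzWith L (A.localField i))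
    {G : ℝ} (hG : ∀ n i, ‖A.localField i (A.avg x n)‖ ≤ G) (n : ℕ) :
    A.disagreement x (n + 1) ≤ (1 + 2 * B * L * A.a n) * A.disagreement x n +
      2 * B * (A.a n * G + ∑ i, A.a n * ‖A.localError x n i‖) := by
  set N := ∑ i, ‖A.localError x n i‖ with hN
  set D := A.disagreement x n with hD
  have hfield : ∀ i, ‖A.localField i (A.agent x n i) + A.localError x n i‖ ≤ G + L * D + N := by
    intro i
    have h1 := (hL i).dist_le_mul (A.agent x n i) (A.avg x n)
    rw [dist_eq_norm, dist_eq_norm] at h1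
    have h2 : (L : ℝ) * ‖A.agent x n i - A.avg x n‖ ≤ L * D :=
      mul_le_mul_of_nonneg_left (norm_agent_sub_avg_le n i) L.2
    have h3 : ‖A.localError x n i‖ ≤ N :=
      Finset.single_le_sum (f := fun i => ‖A.localError x n i‖) (fun _ _ => norm_nonneg _)
        (Finset.mem_univ i)
    have h4 : ‖A.localField i (A.agent x n i)‖ ≤ ‖A.localField i (A.avg x n)‖ +
        ‖A.localField i (A.agent x n i) - A.localField i (A.avg x n)‖ :=
      norm_le_norm_add_norm_sub' _ _
    linarith [norm_add_le (A.localField i (A.agent x n i)) (A.localError x n i), hG n i]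
  have hmean := norm_sum_smul_le hp hp1 hfield
  have hD0 : 0 ≤ D := disagreement_nonneg n
  have hstep : A.disagreement x (n + 1) ≤
      ∑ i, (‖A.agent x n i - A.avg x n‖ + A.a n * (2 * (G + L * D + N))) := by
    by_cases hn : (n + 1) % A.K = 0
    · rw [disagreement_eq_zero hp1 hn]
      refine Finset.sum_nonneg fun i _ => add_nonneg (norm_nonneg _) ?_
      have := (norm_nonneg _).trans (hfield i)
      have := (ha n).le
      positivity
    · refine Finset.sum_le_sum fun i _ => ?_
      rw [avg_succ_eq_add hp1 hab, agent, if_neg hn, localStep_eq hab, add_sub_add_comm,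
        ← smul_sub]
      refine (norm_add_le _ _).trans (add_le_add le_rfl ?_)
      rw [norm_smul, Real.norm_of_nonneg (ha n).le]
      refine mul_le_mul_of_nonneg_left ((norm_sub_le _ _).trans ?_) (ha n).le
      linarith [hfield i]
  refine hstep.trans (le_of_eq ?_)
  rw [Finset.sum_add_distrib, Finset.sum_const, Finset.card_univ, Fintype.card_fin, nsmul_eq_mul,
    ← Finset.mul_sum, ← hN]
  change D + _ = _
  ring

theorem tendsto_disagreement (hp : ∀ i, 0 ≤ A.p i) (hp1 : ∑ i, A.p i = 1) (hK : 0 < A.K)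
    (hab : ∀ n, A.a n = A.b n) (ha : ∀ n, 0 < A.a n) (ha0 : Tendsto A.a atTop (𝓝 0))
    (hL : ∀ i, LipschitzWith L (A.localField i)) {C : ℝ} (hC : ∀ n, ‖A.avg x n‖ ≤ C)
    (herr : ∀ i, Tendsto (fun n => A.a n * ‖A.localError x n i‖) atTop (𝓝 0)) :
    Tendsto (A.disagreement x) atTop (𝓝 0) := by
  have hG : ∀ n i, ‖A.localField i (A.avg x n)‖ ≤ ∑ j, ‖A.localField j 0‖ + L * C := by
    intro n i
    have h1 := (hL i).dist_le_mul (A.avg x n) 0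
    rw [dist_eq_norm, dist_zero_right] at h1
    have h2 : (L : ℝ) * ‖A.avg x n‖ ≤ L * C := mul_le_mul_of_nonneg_left (hC n) L.2
    have h3 : ‖A.localField i 0‖ ≤ ∑ j, ‖A.localField j 0‖ :=
      Finset.single_le_sum (f := fun j => ‖A.localField j 0‖) (fun _ _ => norm_nonneg _)
        (Finset.mem_univ i)
    have h4 : ‖A.localField i (A.avg x n)‖ ≤ ‖A.localField i 0‖ +
        ‖A.localField i (A.avg x n) - A.localField i 0‖ := norm_le_norm_add_norm_sub' _ _
    linarith
  refine tendsto_zero_of_periodic_reset hK disagreement_nonneg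
    (by simpa using ha0.const_mul (2 * B * (L : ℝ))) ?_ (fun n => disagreement_eq_zero hp1)
    (disagreement_succ_le hp hp1 hab ha hL hG)
  simpa using ((ha0.mul_const (∑ j, ‖A.localField j 0‖ + L * C)).add
    (tendsto_finsetSum Finset.univ fun i _ => herr i)).const_mul (2 * (B : ℝ))

/-- Along a sample path with bounded averages and controlled noise, the interpolated averages shadow
the ODE of the centralized GAN. -/
theorem forwardTracks_zbar (hp : ∀ i, 0 ≤ A.p i) (hp1 : ∑ i, A.p i = 1) (hK : 0 < A.K)
    (hab : ∀ n, A.a n = A.b n) (ha : ∀ n, 0 < A.a n) (ha0 : Tendsto A.a atTop (𝓝 0))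
    (ha1 : Tendsto (stepTime A.a) atTop atTop)
    (hq : ∀ z, A.q z = ∑ i, A.p i • A.localField i z)
    (hL : ∀ i, LipschitzWith L (A.localField i)) {C : ℝ} (hC : ∀ n, ‖A.avg x n‖ ≤ C)
    (herr : ∀ i, Tendsto (fun n => A.a n * ‖A.localError x n i‖) atTop (𝓝 0))
    {l : Vec dw × Vec dθ}
    (hm : Tendsto (fun n => ∑ k ∈ Finset.range n, A.a k • (A.noiseW x k, A.noiseθ x k)) atTop
      (𝓝 l)) :
    ForwardTracks A.q (A.zbar x) := by
  have hD := tendsto_disagreement hp hp1 hK hab ha ha0 hL hC herr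
  -- By definition `A.zbar x` unfolds to `interpolant A.a (A.avg x)`.
  refine forwardTracks_of_stochastic_approximation (z := A.avg x)
    (lipschitzWith_q hp hp1 hq hL) ha ha0 ha1 (avg_succ_eq hp1 hab hq) hC ?_ hm
  refine squeeze_zero_norm (a := fun n => L * A.disagreement x n) (fun n => ?_)
    (by simpa using hD.const_mul (L : ℝ))
  refine norm_sum_smul_le hp hp1 fun i => ?_
  have h1 := (hL i).dist_le_mul (A.agent x n i) (A.avg x n)
  rw [dist_eq_norm, dist_eq_norm] at h1
  exact h1.trans (mul_le_mul_of_nonneg_left (norm_agent_sub_avg_le n i) L.2)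

end FedGAN

/-! ### Measurability and convergence of the FedGAN noise -/

namespace FedGAN

variable {B dw dθ : ℕ} {Ξ Ω : Type*} [MeasurableSpace Ω] {P : Measure Ω}
  {A : FedGAN B dw dθ Ξ} {ξ : ℕ → Fin B → Ω → Ξ}

/-- Weighted means of square-integrable noises that form martingale differences have almost surely
convergent series. -/
theorem ae_tendsto_sum_smul_weighted [IsProbabilityMeasure P] (hp : ∀ i, 0 ≤ A.p i)
    (hp1 : ∑ i, A.p i = 1) (ha2 : Summable fun n => A.a n ^ 2) {d : ℕ}
    {F : ℕ → MeasurableSpace Ω} {M : ℕ → Ω → Vec d} (hM : IsMartingaleDiff P F M)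
    {f : ℕ → Fin B → Ω → Vec d} (hMf : ∀ n ω, M n ω = -∑ i, A.p i • f n i ω)
    (hf : ∀ n i, AEStronglyMeasurable (f n i) P) {V : ℝ} (hV0 : 0 ≤ V)
    (hV : ∀ n i, ∫⁻ ω, ‖f n i ω‖ₑ ^ 2 ∂P ≤ ENNReal.ofReal V) :
    ∀ᵐ ω ∂P, ∃ l, Tendsto (fun n => ∑ k ∈ Finset.range n, A.a k • M k ω) atTop (𝓝 l) := by
  have hfL2 : ∀ n i, MemLp (f n i) 2 P := fun n i =>
    memLp_two_of_lintegral_enorm_sq_le (hf n i) (hV n i)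
  have hfsq : ∀ n i, Integrable (fun ω => ‖f n i ω‖ ^ 2) P := fun n i =>
    (hfL2 n i).integrable_norm_pow two_ne_zero
  have hL2 : ∀ n, MemLp (M n) 2 P := fun n => by
    have : M n = fun ω => -∑ i, A.p i • f n i ω := funext (hMf n)
    rw [this]
    exact (memLp_finsetSum _ fun i _ => (hfL2 n i).const_smul (A.p i)).neg
  refine hM.ae_tendsto_sum hL2 (V := V) (fun n => ?_) ha2
  calc ∫ ω, ‖M n ω‖ ^ 2 ∂P ≤ ∫ ω, ∑ i, A.p i * ‖f n i ω‖ ^ 2 ∂P := by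
        refine integral_mono ((hL2 n).integrable_norm_pow two_ne_zero)
          (integrable_finsetSum _ fun i _ => (hfsq n i).const_mul (A.p i)) fun ω => ?_
        simp only [hMf, norm_neg]
        exact norm_sum_smul_sq_le hp hp1 _
    _ = ∑ i, A.p i * ∫ ω, ‖f n i ω‖ ^ 2 ∂P := by
        rw [integral_finsetSum _ fun i _ => (hfsq n i).const_mul (A.p i)]
        simp_rw [integral_const_mul]
    _ ≤ ∑ i, A.p i * V := Finset.sum_le_sum fun i _ => mul_le_mul_of_nonneg_left
        (integral_norm_sq_le_of_lintegral (hf n i) hV0 (hV n i)) (hp i)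
    _ = V := by rw [← Finset.sum_mul, hp1, one_mul]

variable [MeasurableSpace Ξ]

theorem measurable_sgradD_comp (hmD : ∀ i, Measurable fun y : Vec dθ × Vec dw × Ξ =>
    A.sgradD i y.1 y.2.1 y.2.2) (hξ : ∀ n i, Measurable (ξ n i)) {u : Ω → Vec dw × Vec dθ}
    (hu : Measurable u) (n : ℕ) (i : Fin B) :
    Measurable fun ω => A.sgradD i (u ω).2 (u ω).1 (ξ n i ω) :=
  (hmD i).comp (hu.snd.prodMk (hu.fst.prodMk (hξ n i)))

theorem measurable_sgradG_comp (hmG : ∀ i, Measurable fun y : Vec dθ × Vec dw × Ξ =>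
    A.sgradG i y.1 y.2.1 y.2.2) (hξ : ∀ n i, Measurable (ξ n i)) {u : Ω → Vec dw × Vec dθ}
    (hu : Measurable u) (n : ℕ) (i : Fin B) :
    Measurable fun ω => A.sgradG i (u ω).2 (u ω).1 (ξ n i ω) :=
  (hmG i).comp (hu.snd.prodMk (hu.fst.prodMk (hξ n i)))

theorem measurable_agent (hξ : ∀ n i, Measurable (ξ n i))
    (hmD : ∀ i, Measurable fun y : Vec dθ × Vec dw × Ξ => A.sgradD i y.1 y.2.1 y.2.2)
    (hmG : ∀ i, Measurable fun y : Vec dθ × Vec dw × Ξ => A.sgradG i y.1 y.2.1 y.2.2) (n : ℕ) :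
    ∀ i, Measurable fun ω => A.agent (fun m j => ξ m j ω) n i := by
  induction n with
  | zero => exact fun i => measurable_const
  | succ n ih =>
    have hstep : ∀ i, Measurable fun ω =>
        A.localStep n i (A.agent (fun m j => ξ m j ω) n i) (ξ n i ω) := fun i =>
      ((ih i).fst.add ((measurable_sgradD_comp hmD hξ (ih i) n i).const_smul (A.a n))).prodMk
        ((ih i).snd.add ((measurable_sgradG_comp hmG hξ (ih i) n i).const_smul (A.b n)))
    intro i
    simp only [agent]
    split_ifs
    · exact Finset.measurable_fun_sum _ fun j _ => (hstep j).const_smul (A.p j)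
    · exact hstep i

end FedGAN

/-! ### The main theorem -/

theorem mainTheorem2 {B dw dθ : ℕ} {Ξ Ω : Type*} [MeasurableSpace Ξ] [MeasurableSpace Ω]
    (P : Measure Ω) [IsProbabilityMeasure P]
    -- the algorithm, with random mini-batches `ξ n i`
    (A : FedGAN B dw dθ Ξ) (ξ : ℕ → Fin B → Ω → Ξ)
    (hp : ∀ i, 0 ≤ A.p i) (hp1 : ∑ i, A.p i = 1) (hK : 0 < A.K)
    (hξ : ∀ n i, Measurable (ξ n i))
    (hmD : ∀ i, Measurable fun y : Vec dθ × Vec dw × Ξ => A.sgradD i y.1 y.2.1 y.2.2)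
    (hmG : ∀ i, Measurable fun y : Vec dθ × Vec dw × Ξ => A.sgradG i y.1 y.2.1 y.2.2)
    -- the true gradients exist and are Lipschitz
    (hdD : ∀ i θ, Differentiable ℝ fun w => A.lossD i θ w)
    (hdG : ∀ i w, Differentiable ℝ fun θ => A.lossG i θ w)
    (L : ℝ≥0)
    (hLg : ∀ i, LipschitzWith L fun z : Vec dw × Vec dθ => A.localG i z.2 z.1)
    (hLh : ∀ i, LipschitzWith L fun z : Vec dw × Vec dθ => A.localH i z.2 z.1)
    -- equal time-scale learning rates
    (hab : ∀ n, A.a n = A.b n) (ha : ∀ n, 0 < A.a n)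
    (ha1 : Tendsto (fun n => ∑ m ∈ Finset.range n, A.a m) atTop atTop)
    (ha2 : Summable fun n => A.a n ^ 2)
    -- the stochastic gradient errors are martingale differences
    (hMw : IsMartingaleDiff P (A.sigmaField ξ) fun n ω => A.noiseW (fun m i => ξ m i ω) n)
    (hMθ : IsMartingaleDiff P (A.sigmaField ξ) fun n ω => A.noiseθ (fun m i => ξ m i ω) n)
    -- almost sure boundedness of the averaged iterates
    (hbdd : ∀ᵐ ω ∂P, ∃ C : ℝ, ∀ n,
      ‖(A.avg (fun m i => ξ m i ω) n).1‖ ≤ C ∧ ‖(A.avg (fun m i => ξ m i ω) n).2‖ ≤ C)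
    -- bounded variance of the local stochastic gradients
    (σg σh : ℝ)
    (hσg : ∀ n i, ∫⁻ ω, ‖A.sgradD i (A.agent (fun m j => ξ m j ω) n i).2
        (A.agent (fun m j => ξ m j ω) n i).1 (ξ n i ω)
      - A.localG i (A.agent (fun m j => ξ m j ω) n i).2
        (A.agent (fun m j => ξ m j ω) n i).1‖ₑ ^ 2 ∂P ≤ ENNReal.ofReal (σg ^ 2))
    (hσh : ∀ n i, ∫⁻ ω, ‖A.sgradG i (A.agent (fun m j => ξ m j ω) n i).2
        (A.agent (fun m j => ξ m j ω) n i).1 (ξ n i ω)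
      - A.localH i (A.agent (fun m j => ξ m j ω) n i).2
        (A.agent (fun m j => ξ m j ω) n i).1‖ₑ ^ 2 ∂P ≤ ENNReal.ofReal (σh ^ 2)) :
    ∀ᵐ ω ∂P,
      AsymptoticallyTracks A.q (A.zbar fun m i => ξ m i ω) ∧
      ∃ S : Set (Vec dw × Vec dθ), IsCompact S ∧ IsConnected S ∧ IsInvariantSet A.q S ∧
        IsInternallyChainTransitive A.q S ∧
        Tendsto (fun n => Metric.infDist (A.avg (fun m i => ξ m i ω) n) S) atTop (𝓝 0) := by
  have hL := FedGAN.lipschitzWith_localField hLg hLh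
  have hq := FedGAN.q_eq_sum hdD hdG
  have hag := FedGAN.measurable_agent hξ hmD hmG
  have hmeasD : ∀ n i, Measurable fun ω => (A.localError (fun m j => ξ m j ω) n i).1 := fun n i =>
    (FedGAN.measurable_sgradD_comp hmD hξ (hag n i) n i).sub
      ((hLg i).continuous.measurable.comp (hag n i))
  have hmeasG : ∀ n i, Measurable fun ω => (A.localError (fun m j => ξ m j ω) n i).2 := fun n i =>
    (FedGAN.measurable_sgradG_comp hmG hξ (hag n i) n i).sub
      ((hLh i).continuous.measurable.comp (hag n i))
  have ha0 : Tendsto A.a atTop (𝓝 0) := by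
    have := ha2.tendsto_atTop_zero.sqrt
    simpa only [Real.sqrt_sq (ha _).le, Real.sqrt_zero] using this
  have hconvW := FedGAN.ae_tendsto_sum_smul_weighted hp hp1 ha2 hMw
    (f := fun n i ω => (A.localError (fun m j => ξ m j ω) n i).1)
    (fun n ω => by simpa [Prod.fst_sum] using congrArg Prod.fst (FedGAN.noise_eq n))
    (fun n i => (hmeasD n i).aestronglyMeasurable) (sq_nonneg σg) hσg
  have hconvθ := FedGAN.ae_tendsto_sum_smul_weighted hp hp1 ha2 hMθ
    (f := fun n i ω => (A.localError (fun m j => ξ m j ω) n i).2)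
    (fun n ω => by simpa [Prod.snd_sum] using congrArg Prod.snd (FedGAN.noise_eq n))
    (fun n i => (hmeasG n i).aestronglyMeasurable) (sq_nonneg σh) hσh
  have herrD := ae_all_iff.2 fun i => ae_tendsto_mul_norm_of_summable_sq
    (fun n => (hmeasD n i).aestronglyMeasurable (μ := P)) ha2 (fun n => hσg n i)
  have herrG := ae_all_iff.2 fun i => ae_tendsto_mul_norm_of_summable_sq
    (fun n => (hmeasG n i).aestronglyMeasurable (μ := P)) ha2 (fun n => hσh n i)
  filter_upwards [hconvW, hconvθ, herrD, herrG, hbdd]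
    with ω ⟨lw, hlw⟩ ⟨lθ, hlθ⟩ hD hG ⟨C, hC⟩
  have hC' : ∀ n, ‖A.avg (fun m i => ξ m i ω) n‖ ≤ C := fun n => max_le (hC n).1 (hC n).2
  have herr : ∀ i, Tendsto (fun n => A.a n * ‖A.localError (fun m j => ξ m j ω) n i‖) atTop
      (𝓝 0) := fun i => by
    have := (hD i).max (hG i)
    rw [max_self] at this
    refine this.congr fun n => ?_
    rw [Prod.norm_def, mul_max_of_nonneg _ _ (ha n).le]
  have hm : Tendsto (fun n => ∑ k ∈ Finset.range n, A.a k •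
      (A.noiseW (fun m i => ξ m i ω) k, A.noiseθ (fun m i => ξ m i ω) k)) atTop
      (𝓝 (lw, lθ)) := by
    refine (hlw.prodMk_nhds hlθ).congr fun n => ?_
    refine Prod.ext ?_ ?_ <;> simp [Prod.fst_sum, Prod.snd_sum]
  have htrack := FedGAN.forwardTracks_zbar hp hp1 hK hab ha ha0 ha1 hq hL hC' herr hm
  have hqL := FedGAN.lipschitzWith_q hp hp1 hq hL
  have hbd : ∀ t ≥ 0, ‖A.zbar (fun m i => ξ m i ω) t‖ ≤ C := fun t ht =>
    norm_interpolant_le (z := A.avg fun m i => ξ m i ω) ha ha1 ht (hC' _) (hC' _)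
  -- `S` is the limit set of the whole interpolated curve; the iterates are its values at the times
  -- `t(n) → ∞`. `IsConnected` includes nonemptiness.
  refine ⟨htrack.asymptoticallyTracks hqL, limitSet (A.zbar fun m i => ξ m i ω),
    isCompact_limitSet hbd, isConnected_limitSet hbd (continuousOn_interpolant ha ha1),
    htrack.isInvariantSet_limitSet hqL, htrack.isInternallyChainTransitive_limitSet hqL hbd, ?_⟩
  refine ((tendsto_infDist_limitSet hbd).comp ha1).congr fun n => ?_
  exact congrArg (fun z => Metric.infDist z _)
    (interpolant_stepTime (z := A.avg fun m i => ξ m i ω) ha n)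

end
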